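/- **Setting.** Let $d\ge 1$, let $N_0=\{\pm e_1,\dots,\pm e_d,0\}\subset\mathbb Z^d$, and let $S$ be a Polish space of probability measures on $N_0$ (for $s\in S$ write $s(y)$ for the mass of $y$; $s(y)=0$ for $y\notin N_0$, and $s\mapsto s(y)$ is measurable). Let $K$ be a Markov kernel on $S$ with a unique stationary law $\pi$. The environment $\omega=(\omega_t(x))_{t\ge 0,\,x\in\mathbb Z^d}$ has law $\mathbf P^\pi$: the processes $(\omega_t(x))_{t\ge0}$, $x\in\mathbb Z^d$, are i.i.d. stationary Markov chains on $S$ with kernel $K$ and initial law $\pi$. Write $\omega_t(x,y)=\omega_t(x)(y-x)$. Given $\omega$, the walk $(X_t)_{t\ge 0}$ is the time-inhomogeneous Markov chain on $\mathbb Z^d$ with $X_0=0$ and $\mathbf P_\omega(X_{t+1}=y\mid X_t=x)=\omega_t(x,y)$. The annealed law $\mathbb P^0$ of $(\omega,X)$ is $\mathbb P^0(F\times G)=\int_F \mathbf P^0_\omega(G)\,\mathbf P^\pi(d\omega)$. **Assumption 1.** There are $0<\kappa\le 1$, $0<\varepsilon<1$ and a probability measure $q$ on $N_0$ such that * (A1)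 $K(w,A)\ge\kappa\,\pi(A)$ for all $w\in S$ and all Borel $A\subset S$; * (A2) $\bigl|\sum_{|y|_1=1}q(y)e^{i\,\ell\cdot y}\bigr|<1$ for all $\ell\in\mathbb Z^d\setminus\{0\}$, and $\mathbf P^\pi(\omega_t(x,y)\ge\varepsilon\,q(y-x))=1$ for all $x,y\in\mathbb Z^d$, $t\ge0$; * (A3) $\kappa+\varepsilon^2>1$. **Regeneration time.** Enlarge the probability space as follows. At each site $x$, independently over sites, $\omega_0(x)\sim\pi$, and for $t\ge1$ an independent Bernoulli($\kappa$) coin $\alpha_t(x)$ is tossed; given the past, $\omega_t(x)$ is drawn from $\pi$ if $\alpha_t(x)=1$, and from $(K(\omega_{t-1}(x),\cdot)-\kappa\pi)/(1-\kappa)$ if $\alpha_t(x)=0$ (the latter does not occur a.s. if $\kappa=1$). Let $(\epsilon_t)_{t\ge1}$ be i.i.d. Bernoulli($\varepsilon$), independent of these. Given all of this, $X$ is the Markov chain started at $0$ whose step from time $t$ to $t+1$ goes from $x$ to $y$ with probability $q(y-x)$ if $\epsilon_{t+1}=1$ and $(\omega_t(x,y)-\varepsilon q(y-x))/(1-\varepsilon)$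 if $\epsilon_{t+1}=0$. Write $\overline{\mathbb P}^0$, $\overline{\mathbb E}^0$ for the resulting law and expectation. For $t\ge 0$ and $x\in\mathbb Z^d$ let $\gamma_t(x)=\max\{1\le s\le t: X_{s-1}=x,\ \epsilon_s=0\}$ and $\eta_t(x)=\inf\{s\ge0:\alpha_{\gamma_t(x)+s}(x)=1\}$, with $\gamma_t(x)=\eta_t(x)=0$ if there is no such $s\le t$ in the first definition, and let $$\tau_1=\inf\{t>0:\ \gamma_t(x)+\eta_t(x)<t\ \text{ for all }x\in\mathbb Z^d\}.$$ **Theorem (annealed strong law of large numbers).** Let Assumption 1 hold. Then there is a deterministic $v\in\mathbb R^d$ such that $$\frac{X_n}{n}\longrightarrow v\qquad \mathbb P^0\text{-almost surely as } n\to\infty .$$ Moreover, for every choice of $\kappa,\varepsilon,q$ as in Assumption 1, $\tau_1<\infty$ $\overline{\mathbb P}^0$-a.s., $\tau_1$ and $X_{\tau_1}$ are integrable under $\overline{\mathbb P}^0$, and $$v=\frac{\overline{\mathbb E}^0[X_{\tau_1}]}{\overline{\mathbb E}^0[\tau_1]} .$$ -/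

import Mathlib

open MeasureTheory ProbabilityTheory Filter Topology
open scoped unitInterval NNReal ENNReal

noncomputable section

namespace DynRWRE

/-! ### Markov chains, possibly depending on a parameter -/

section Chains

variable {E Θ : Type*} [MeasurableSpace E] [MeasurableSpace Θ]

/-- The law on `ℕ → E` of the (time inhomogeneous) Markov chain with initial law `μ₀` whose
transition from time `n` to time `n + 1` is made with the kernel `κ n`. -/
def chainLaw (μ₀ : Measure E) (κ : ℕ → Kernel E E) [∀ n, IsMarkovKernel (κ n)] :
    Measure (ℕ → E) :=
  Kernel.trajMeasure (X := fun _ => E) μ₀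
    (fun n => (κ n).comap (fun h => h ⟨n, Finset.mem_Iic.2 le_rfl⟩) (by fun_prop))

instance (μ₀ : Measure E) [IsProbabilityMeasure μ₀] (κ : ℕ → Kernel E E)
    [∀ n, IsMarkovKernel (κ n)] : IsProbabilityMeasure (chainLaw μ₀ κ) := by
  unfold chainLaw; infer_instance

/-- The law of a Markov chain depends measurably on the parameter of its transition kernels. -/
theorem measurable_chainLaw (κ : ℕ → Kernel (Θ × E) E) [∀ n, IsMarkovKernel (κ n)] (x : E) :
    Measurable fun θ => chainLaw (Measure.dirac x) (fun n => (κ n).sectR θ) := by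
  have key : ∀ n : ℕ, ∃ η : Kernel Θ (Π _ : Finset.Iic n, E), IsMarkovKernel η ∧
      ∀ θ, (chainLaw (Measure.dirac x) (fun n => (κ n).sectR θ)).map
        (Preorder.frestrictLe (π := fun _ => E) n) = η θ := by
    intro n
    induction n with
    | zero =>
      refine ⟨Kernel.const _ (Measure.dirac fun _ => x), inferInstance, fun θ => ?_⟩
      rw [chainLaw, Kernel.trajMeasure, Measure.map_comp _ _ (by fun_prop),
        Kernel.traj_map_frestrictLe, Kernel.partialTraj_self, Measure.id_comp,
        Kernel.const_apply]
      exact Measure.map_dirac' (MeasurableEquiv.measurable _) _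
    | succ n ih =>
      obtain ⟨η, hη, h⟩ := ih
      let e : (Π _ : Finset.Iic n, E) × E → (Π _ : Finset.Iic (n + 1), E) :=
        fun z i => if hi : i.1 ≤ n then z.1 ⟨i.1, Finset.mem_Iic.2 hi⟩ else z.2
      have he : Measurable e := by
        refine measurable_pi_lambda _ fun i => ?_
        by_cases hi : i.1 ≤ n
        · simp only [e, hi, dite_true]; fun_prop
        · simp only [e, hi, dite_false]; fun_prop
      let κ' : Kernel (Θ × (Π _ : Finset.Iic n, E)) E :=
        (κ n).comap (fun z => (z.1, z.2 ⟨n, Finset.mem_Iic.2 le_rfl⟩)) (by fun_prop)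
      refine ⟨(η ⊗ₖ κ').map e, Kernel.IsMarkovKernel.map _ he, fun θ => ?_⟩
      have h2 := Kernel.map_frestrictLe_trajMeasure_compProd_eq_map_trajMeasure
        (X := fun _ => E) (μ₀ := Measure.dirac x)
        (κ := fun n => ((κ n).sectR θ).comap
          (fun h : Π _ : Finset.Iic n, E => h ⟨n, Finset.mem_Iic.2 le_rfl⟩) (by fun_prop))
        (a := n)
      have h3 : (Preorder.frestrictLe (π := fun _ => E) (n + 1)) =
          e ∘ (fun y : ℕ → E => (Preorder.frestrictLe (π := fun _ => E) n y, y (n + 1))) := by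
        funext y i
        by_cases hi : i.1 ≤ n
        · simp [e, hi]
        · have : i.1 = n + 1 := le_antisymm (Finset.mem_Iic.1 i.2) (by omega)
          simp [e, this]
      have h4 := h θ
      rw [chainLaw] at h4 ⊢
      rw [h3, ← Measure.map_map he (by fun_prop), ← h2, h4, Kernel.map_apply _ he]
      congr 1
      ext s hs
      rw [Measure.compProd_apply hs, Kernel.compProd_apply hs]
      rfl
  refine Measurable.measure_of_isPiSystem_of_isProbabilityMeasure
    (generateFrom_measurableCylinders (α := fun _ : ℕ => E)).symm
    isPiSystem_measurableCylinders fun t ht => ?_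
  obtain ⟨N, S, mS, rfl⟩ : ∃ N S, MeasurableSet S ∧
      t = cylinder (α := fun _ : ℕ => E) (Finset.Iic N) S := by
    simpa [measurableCylinders_nat] using ht
  obtain ⟨η, -, h⟩ := key N
  have : (fun θ => chainLaw (Measure.dirac x) (fun n => (κ n).sectR θ)
      (cylinder (α := fun _ : ℕ => E) (Finset.Iic N) S)) = fun θ => η θ S := by
    funext θ
    rw [← h θ, Measure.map_apply (by fun_prop) mS]
    rfl
  rw [this]
  exact η.measurable_coe mS

/-- The law of the Markov chain started at `x`, whose transitions depend on a parameter `θ`, as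
a kernel from the space of parameters to the space of paths. -/
def chainKernel (κ : ℕ → Kernel (Θ × E) E) [∀ n, IsMarkovKernel (κ n)] (x : E) :
    Kernel Θ (ℕ → E) where
  toFun θ := chainLaw (Measure.dirac x) (fun n => (κ n).sectR θ)
  measurable' := measurable_chainLaw κ x

instance (κ : ℕ → Kernel (Θ × E) E) [∀ n, IsMarkovKernel (κ n)] (x : E) :
    IsMarkovKernel (chainKernel κ x) :=
  ⟨fun θ => by
    change IsProbabilityMeasure (chainLaw (Measure.dirac x) (fun n => (κ n).sectR θ))
    infer_instance⟩

open Classical in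
/-- The residual kernel `w ↦ (k w - c m) / (1 - c)`. It is only meant for `c < 1` and at those
points `w` where `c m ≤ k w`; elsewhere the value `k w` is used as a convention. (The set of those
points is always measurable in the applications below.) -/
def residualKernel (k : Kernel Θ E) (m : Measure E) [IsFiniteMeasure m] (c : I) : Kernel Θ E :=
  if h : c < 1 ∧ MeasurableSet {w | unitInterval.toNNReal c • m ≤ k w} then
    { toFun := fun w =>
        if unitInterval.toNNReal c • m ≤ k w then (unitInterval.toNNReal (σ c))⁻¹ • (k w - unitInterval.toNNReal c • m) else k w
      measurable' := by
        refine Measure.measurable_of_measurable_coe _ fun A hA => ?_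
        have : (fun w => (if unitInterval.toNNReal c • m ≤ k w then
              (unitInterval.toNNReal (σ c))⁻¹ • (k w - unitInterval.toNNReal c • m) else k w) A) =
            fun w => if w ∈ {w | unitInterval.toNNReal c • m ≤ k w} then
              (unitInterval.toNNReal (σ c))⁻¹ • (k w A - (unitInterval.toNNReal c • m) A) else k w A := by
          funext w
          by_cases hw : unitInterval.toNNReal c • m ≤ k w
          · simp [hw, Measure.sub_apply hA hw]
          · simp [hw]
        rw [this]
        have hk := k.measurable_coe hA
        exact Measurable.ite h.2 ((hk.sub_const _).const_smul _) hk }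
  else k

open Classical in
instance (k : Kernel Θ E) [IsMarkovKernel k] (m : Measure E) [IsProbabilityMeasure m] (c : I) :
    IsMarkovKernel (residualKernel k m c) := by
  unfold residualKernel
  split_ifs with h
  · refine ⟨fun w => ⟨?_⟩⟩
    change (if unitInterval.toNNReal c • m ≤ k w then
      (unitInterval.toNNReal (σ c))⁻¹ • (k w - unitInterval.toNNReal c • m) else k w) Set.univ = 1
    split_ifs with hw
    · have h1 : unitInterval.toNNReal c + unitInterval.toNNReal (σ c) = 1 := by ext; simp
      have h2 : unitInterval.toNNReal (σ c) ≠ 0 := by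
        intro h0
        have : unitInterval.toNNReal c = 1 := by simpa [h0] using h1
        have h3 : (c : ℝ) = 1 := by simpa using congrArg NNReal.toReal this
        exact h.1.ne (Subtype.ext h3)
      have h3 : (1 : ℝ≥0∞) - (unitInterval.toNNReal c : ℝ≥0∞) = (unitInterval.toNNReal (σ c) : ℝ≥0∞) := by
        rw [← ENNReal.coe_one, ← ENNReal.coe_sub, ← h1, add_tsub_cancel_left]
      rw [Measure.smul_apply, Measure.sub_apply MeasurableSet.univ hw, Measure.smul_apply,
        measure_univ, measure_univ]
      simp only [ENNReal.smul_def, smul_eq_mul, mul_one]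
      rw [h3, ← ENNReal.coe_mul, inv_mul_cancel₀ h2, ENNReal.coe_one]
    · exact measure_univ
  · infer_instance

/-- The kernel which uses `k₁` if the coin shows `true`, and `k₀` otherwise. -/
def byCoin (k₁ k₀ : Kernel Θ E) : Kernel (Bool × Θ) E where
  toFun z := if z.1 = true then k₁ z.2 else k₀ z.2
  measurable' := Measurable.ite (measurable_fst (measurableSet_singleton true))
    (k₁.measurable.comp measurable_snd) (k₀.measurable.comp measurable_snd)

instance (k₁ k₀ : Kernel Θ E) [IsMarkovKernel k₁] [IsMarkovKernel k₀] :
    IsMarkovKernel (byCoin k₁ k₀) :=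
  ⟨fun z => by
    change IsProbabilityMeasure (if z.1 = true then k₁ z.2 else k₀ z.2)
    split_ifs <;> infer_instance⟩

end Chains

/-! ### The model -/

/-- The lattice `ℤ ^ d`. -/
abbrev LatticePt (d : ℕ) : Type := Fin d → ℤ

/-- The neighbours `{± e_i} ∪ {0}` of the origin, the origin included. -/
def nbhd (d : ℕ) : Set (LatticePt d) := {y | ∑ i, |y i| ≤ 1}

/-- The point `x` of the lattice, seen in `ℝ ^ d`. -/
def toVec {d : ℕ} (x : LatticePt d) : Fin d → ℝ := fun i => (x i : ℝ)

section Model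

variable {d : ℕ} {S : Type*} [MeasurableSpace S]

/-- An environment: `ω x t : S` is the state at time `t` of the chain attached to the site `x`. -/
abbrev Env (d : ℕ) (S : Type*) : Type _ := LatticePt d → ℕ → S

/-- The law of the environment: the chains at the various sites are independent, and each of them
is the Markov chain with transition kernel `K` and initial law `π`. -/
def envLaw (d : ℕ) (K : Kernel S S) [IsMarkovKernel K] (π : Measure S) : Measure (Env d S) :=
  Measure.infinitePi fun _ : LatticePt d => chainLaw π fun _ => K

instance (K : Kernel S S) [IsMarkovKernel K] (π : Measure S) [IsProbabilityMeasure π] :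
    IsProbabilityMeasure (envLaw d K π) := by
  unfold envLaw; infer_instance

/-- Given a kernel `k` of jumps, whose argument is read off from a parameter and the current
position, the kernel which adds the jump to the current position. -/
def walkStep {Θ T : Type*} [MeasurableSpace Θ] [MeasurableSpace T] (k : Kernel T (LatticePt d))
    (g : Θ × LatticePt d → T) (hg : Measurable g) : Kernel (Θ × LatticePt d) (LatticePt d) :=
  (Kernel.deterministic Prod.snd measurable_snd ×ₖ k.comap g hg).map fun z => z.1 + z.2

instance {Θ T : Type*} [MeasurableSpace Θ] [MeasurableSpace T] (k : Kernel T (LatticePt d))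
    [IsMarkovKernel k] (g : Θ × LatticePt d → T) (hg : Measurable g) :
    IsMarkovKernel (walkStep k g hg) :=
  Kernel.IsMarkovKernel.map _ (by fun_prop)

theorem measurable_state (t : ℕ) : Measurable fun z : Env d S × LatticePt d => z.1 z.2 t :=
  measurable_from_prod_countable_left fun x => by
    change Measurable fun ω : Env d S => ω x t
    fun_prop

/-- The quenched law of the walk started at `x`, as a kernel from the environments to the paths.
Given `ω`, it is the law of the Markov chain which goes at time `t` from `x` to `y` with
probability `p (ω x t) {y - x}`. -/
def quenchedLaw (p : Kernel S (LatticePt d)) [IsMarkovKernel p] (x : LatticePt d) :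
    Kernel (Env d S) (ℕ → LatticePt d) :=
  chainKernel (fun t => walkStep p (fun z : Env d S × LatticePt d => z.1 z.2 t)
    (measurable_state t)) x

instance (p : Kernel S (LatticePt d)) [IsMarkovKernel p] (x : LatticePt d) :
    IsMarkovKernel (quenchedLaw (S := S) p x) := by
  unfold quenchedLaw; infer_instance

/-- The annealed law of the environment and the walk started at `x`; it gives
`∫ ω in F, quenchedLaw p x ω G ∂(envLaw d K π)` to `F ×ˢ G`. -/
def annealedLaw (p : Kernel S (LatticePt d)) [IsMarkovKernel p] (K : Kernel S S) [IsMarkovKernel K]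
    (π : Measure S) (x : LatticePt d) : Measure (Env d S × (ℕ → LatticePt d)) :=
  envLaw d K π ⊗ₘ quenchedLaw p x

instance (p : Kernel S (LatticePt d)) [IsMarkovKernel p] (K : Kernel S S) [IsMarkovKernel K]
    (π : Measure S) [IsProbabilityMeasure π] (x : LatticePt d) :
    IsProbabilityMeasure (annealedLaw p K π x) := by
  unfold annealedLaw; infer_instance

/-- The hypotheses on the model: (A1) minorization of the environment chain with constant `κ`,
(A2) ellipticity with constant `ε` and a non-degenerate jump law `q` on the nearest neighbours (the
translation invariant kernel being `q(x, y) = q {y - x}`), (A3) the relation of the constants. -/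
structure Assumption (p : Kernel S (LatticePt d)) (K : Kernel S S) [IsMarkovKernel K]
    (π : Measure S) (κ ε : I) (q : Measure (LatticePt d)) : Prop where
  kappa_pos : 0 < κ
  minorization : ∀ w A, MeasurableSet A → (κ : ℝ) * π.real A ≤ (K w).real A
  eps_pos : 0 < ε
  eps_lt_one : ε < 1
  nearest_neighbour : q (nbhd d)ᶜ = 0
  nondegenerate : ∀ l : LatticePt d, l ≠ 0 →
    ‖∑' y : {y : LatticePt d // ∑ i, |y i| = 1},
      (q.real {y.1} : ℂ) * Complex.exp (Complex.I * ∑ i, (l i : ℂ) * (y.1 i : ℂ))‖ < 1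
  elliptic : ∀ (x y : LatticePt d) (t : ℕ),
    ∀ᵐ ω ∂(envLaw d K π), (ε : ℝ) * q.real {y - x} ≤ (p (ω x t)).real {y - x}
  trade_off : 1 < (κ : ℝ) + (ε : ℝ) ^ 2

/-! ### The regeneration time -/

/-- One step of the environment chain at a site, together with its `κ`-coin: first toss a coin with
success probability `κ`; if it shows `true`, draw the new state from `π`, and otherwise move with
the kernel `(K - κ π) / (1 - κ)`. The first component of the old pair is not used. -/
def coinStep (K : Kernel S S) [IsMarkovKernel K] (π : Measure S) [IsProbabilityMeasure π] (κ : I) :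
    Kernel (Bool × S) (Bool × S) :=
  Kernel.const (Bool × S) (bernoulliMeasure true false κ) ⊗ₖ
    (byCoin (Kernel.const S π) (residualKernel K π κ)).comap (fun z => (z.2, z.1.2)) (by fun_prop)

instance (K : Kernel S S) [IsMarkovKernel K] (π : Measure S) [IsProbabilityMeasure π] (κ : I) :
    IsMarkovKernel (coinStep K π κ) := by
  unfold coinStep; infer_instance

/-- The law of the environment with its `κ`-coins: for `ζ : Env d (Bool × S)`, the state at `x` at
time `t` is `(ζ x t).2`, and for `t ≥ 1` the coin `(ζ x t).1` was used to get there from the state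
at time `t - 1`. The coin at time `0` has no meaning and is set to `false`. -/
def coinEnvLaw (d : ℕ) (K : Kernel S S) [IsMarkovKernel K] (π : Measure S)
    [IsProbabilityMeasure π] (κ : I) : Measure (Env d (Bool × S)) :=
  Measure.infinitePi fun _ : LatticePt d =>
    chainLaw ((Measure.dirac false).prod π) fun _ => coinStep K π κ

instance (K : Kernel S S) [IsMarkovKernel K] (π : Measure S) [IsProbabilityMeasure π] (κ : I) :
    IsProbabilityMeasure (coinEnvLaw d K π κ) := by
  unfold coinEnvLaw; infer_instance

/-- The law of the `ε`-coins, which are independent and show `true` with probability `ε`. Only the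
coins with index at least `1` are used. -/
def epsCoinLaw (ε : I) : Measure (ℕ → Bool) :=
  Measure.infinitePi fun _ => bernoulliMeasure true false ε

instance (ε : I) : IsProbabilityMeasure (epsCoinLaw ε) := by
  unfold epsCoinLaw; infer_instance

/-- The jump of the walk, given the `ε`-coin and the state of the environment: it is drawn from `q`
if the coin shows `true`, and from `(p s - ε q) / (1 - ε)` otherwise. -/
def coinJump (p : Kernel S (LatticePt d)) [IsMarkovKernel p] (ε : I) (q : Measure (LatticePt d))
    [IsProbabilityMeasure q] : Kernel (Bool × S) (LatticePt d) :=
  byCoin (Kernel.const S q) (residualKernel p q ε)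

instance (p : Kernel S (LatticePt d)) [IsMarkovKernel p] (ε : I) (q : Measure (LatticePt d))
    [IsProbabilityMeasure q] : IsMarkovKernel (coinJump p ε q) := by
  unfold coinJump; infer_instance

theorem measurable_coin_state (t : ℕ) :
    Measurable fun z : (Env d (Bool × S) × (ℕ → Bool)) × LatticePt d =>
      (z.1.2 (t + 1), (z.1.1 z.2 t).2) :=
  measurable_from_prod_countable_left fun x => by
    change Measurable fun ω : Env d (Bool × S) × (ℕ → Bool) => (ω.2 (t + 1), (ω.1 x t).2)
    fun_prop

/-- The law of the walk started at `x`, given the environment and the coins; the step from time `t`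
to time `t + 1` uses the `ε`-coin with index `t + 1` and the environment at time `t`. -/
def coinWalkLaw (p : Kernel S (LatticePt d)) [IsMarkovKernel p] (ε : I) (q : Measure (LatticePt d))
    [IsProbabilityMeasure q] (x : LatticePt d) :
    Kernel (Env d (Bool × S) × (ℕ → Bool)) (ℕ → LatticePt d) :=
  chainKernel (fun t => walkStep (coinJump p ε q)
    (fun z : (Env d (Bool × S) × (ℕ → Bool)) × LatticePt d => (z.1.2 (t + 1), (z.1.1 z.2 t).2))
    (measurable_coin_state t)) x

instance (p : Kernel S (LatticePt d)) [IsMarkovKernel p] (ε : I) (q : Measure (LatticePt d))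
    [IsProbabilityMeasure q] (x : LatticePt d) : IsMarkovKernel (coinWalkLaw (S := S) p ε q x) := by
  unfold coinWalkLaw; infer_instance

/-- The annealed law on the enlarged probability space, of the environment with its `κ`-coins, the
`ε`-coins and the walk started at `x`. -/
def extendedLaw (p : Kernel S (LatticePt d)) [IsMarkovKernel p] (K : Kernel S S) [IsMarkovKernel K]
    (π : Measure S) [IsProbabilityMeasure π] (κ ε : I) (q : Measure (LatticePt d))
    [IsProbabilityMeasure q] (x : LatticePt d) :
    Measure ((Env d (Bool × S) × (ℕ → Bool)) × (ℕ → LatticePt d)) :=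
  (coinEnvLaw d K π κ).prod (epsCoinLaw ε) ⊗ₘ coinWalkLaw p ε q x

instance (p : Kernel S (LatticePt d)) [IsMarkovKernel p] (K : Kernel S S) [IsMarkovKernel K]
    (π : Measure S) [IsProbabilityMeasure π] (κ ε : I) (q : Measure (LatticePt d))
    [IsProbabilityMeasure q] (x : LatticePt d) :
    IsProbabilityMeasure (extendedLaw p K π κ ε q x) := by
  unfold extendedLaw; infer_instance

/-- The indices `1 ≤ s ≤ t` of the steps of the walk which start at the site `x` and are made
according to the environment there. -/
def properVisits (X : ℕ → LatticePt d) (e : ℕ → Bool) (t : ℕ) (x : LatticePt d) : Finset ℕ :=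
  {s ∈ Finset.Icc 1 t | X (s - 1) = x ∧ e s = false}

/-- The number of proper visits to `x` up to time `t`. -/
def visitCount (X : ℕ → LatticePt d) (e : ℕ → Bool) (t : ℕ) (x : LatticePt d) : ℕ :=
  (properVisits X e t x).card

/-- The last proper visit to `x` up to time `t`, and `0` if there is none. -/
def lastVisit (X : ℕ → LatticePt d) (e : ℕ → Bool) (t : ℕ) (x : LatticePt d) : ℕ :=
  (properVisits X e t x).sup id

/-- The time after the last proper visit to `x` up to time `t` until the environment at `x` makes a
step according to its stationary law; `0` if there is no proper visit. -/
def freshDelay (a : LatticePt d → ℕ → Bool) (X : ℕ → LatticePt d) (e : ℕ → Bool) (t : ℕ)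
    (x : LatticePt d) : ℕ∞ :=
  if visitCount X e t x = 0 then 0
  else ⨅ s ∈ {s : ℕ | a x (lastVisit X e t x + s) = true}, (s : ℕ∞)

/-- The regeneration time: the first `t > 0` such that at every site the environment has made a step
according to its stationary law since the last proper visit and strictly before `t`. -/
def regenTime (z : (Env d (Bool × S) × (ℕ → Bool)) × (ℕ → LatticePt d)) : ℕ∞ :=
  ⨅ t ∈ {t : ℕ | 0 < t ∧ ∀ x : LatticePt d,
      (lastVisit z.2 z.1.2 t x : ℕ∞) + freshDelay (fun x s => (z.1.1 x s).1) z.2 z.1.2 t x < t},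
    (t : ℕ∞)

end Model

end DynRWRE

end

set_option linter.unusedSectionVars false

/-! A site is called pending when, since the last step made from it according to its environment (a
proper visit), no `κ`-coin there has shown success at a time strictly before the present one. The
walk is recorded by its observations: each step, the `ε`-coin used for it, and the set of pending
sites seen from the walk afterwards. These take countably many values, and `τ₁` is the first time at
which the pending set is empty.

Renewal. Given the coins, the probability of a finite string of observations is a product of one
factor per site (`setLIntegral_observe`). At a non-pending site the current state still has law `π`,
independently of the past. Either it was never properly visited, so that only steps drawn from `q`
were made there and nothing was learnt about the state, or it was redrawn from `π` after the last
proper visit. Coins at non-pending sites are not recorded, so they average out and `π` is preserved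
by invariance. Hence each site factor splits at a time when the site is not pending
(`siteExp_regeneration`), and the whole sequence of observations starts afresh when no site is
pending (`renewsAt_observationLaw`).

Integrability. In one step each pending site is released with probability `κ`, and at most one site
becomes pending, with probability at most `1 - ε`. While the pending set is nonempty its expected
size therefore drops by at least `κ - (1 - ε)`, which is positive because `κ + ε ≥ κ + ε² > 1`.
Foster's criterion (`HasDrift.integrable_blockLength`) makes the first block integrable.

Conclusion. The strong law for the lengths of the blocks and for the displacements over them,
together with bounded steps, gives convergence along all times (`RenewsAt.tendsto_average`).
Averaging out the coins does not change the law of the walk (`map_snd_extendedLaw`), so the limit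
holds under the annealed law as well. -/

noncomputable section

namespace DynRWRE

/-! ### Expectations along Markov chains and under product measures -/

section General

variable {E : Type*} [MeasurableSpace E]

/-- One step of the Markov chain: the state at time `n + 1`, given the path up to time `n`. -/
theorem lintegral_chainLaw_succ (μ₀ : Measure E) [IsProbabilityMeasure μ₀] (κ : ℕ → Kernel E E)
    [∀ n, IsMarkovKernel (κ n)] (n : ℕ) {F : (Π _ : Finset.Iic n, E) → ℝ≥0∞} (hF : Measurable F)
    {g : E → ℝ≥0∞} (hg : Measurable g) :
    ∫⁻ z, F (Preorder.frestrictLe (π := fun _ => E) n z) * g (z (n + 1)) ∂(chainLaw μ₀ κ) =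
      ∫⁻ z, F (Preorder.frestrictLe (π := fun _ => E) n z) * ∫⁻ y, g y ∂(κ n (z n))
        ∂(chainLaw μ₀ κ) := by
  have h := Kernel.map_frestrictLe_trajMeasure_compProd_eq_map_trajMeasure
    (X := fun _ => E) (μ₀ := μ₀)
    (κ := fun n => (κ n).comap (fun h : Π _ : Finset.Iic n, E => h ⟨n, Finset.mem_Iic.2 le_rfl⟩)
      (by fun_prop)) (a := n)
  have hm : Measurable fun w : (Π _ : Finset.Iic n, E) × E => F w.1 * g w.2 := by fun_prop
  have h1 := lintegral_map (μ := chainLaw μ₀ κ) hm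
    (g := fun z => (Preorder.frestrictLe (π := fun _ => E) n z, z (n + 1))) (by fun_prop)
  rw [← h1]
  unfold chainLaw
  erw [← h]
  rw [Measure.lintegral_compProd hm]
  rw [lintegral_map ?_ (by fun_prop)]
  · refine lintegral_congr fun z => ?_
    exact lintegral_const_mul (μ := κ n (z n))
      (F (Preorder.frestrictLe (π := fun _ => E) n z)) hg
  · exact Measurable.lintegral_kernel_prod_right' (κ := (κ n).comap
      (fun h : Π _ : Finset.Iic n, E => h ⟨n, Finset.mem_Iic.2 le_rfl⟩) (by fun_prop)) hm

theorem lintegral_chainLaw_zero (μ₀ : Measure E) [IsProbabilityMeasure μ₀] (κ : ℕ → Kernel E E)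
    [∀ n, IsMarkovKernel (κ n)] {g : E → ℝ≥0∞} (hg : Measurable g) :
    ∫⁻ z, g (z 0) ∂(chainLaw μ₀ κ) = ∫⁻ y, g y ∂μ₀ := by
  have : (chainLaw μ₀ κ).map (fun z => z 0) = μ₀ := by
    have : (fun z : ℕ → E => z 0) =
        (fun h : Π _ : Finset.Iic 0, E => h ⟨0, Finset.mem_Iic.2 le_rfl⟩) ∘
          Preorder.frestrictLe (π := fun _ => E) 0 := rfl
    rw [this, ← Measure.map_map (by fun_prop) (by fun_prop), chainLaw, Kernel.trajMeasure,
      Measure.map_comp _ _ (by fun_prop), Kernel.traj_map_frestrictLe, Kernel.partialTraj_self,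
      Measure.id_comp, Measure.map_map (by fun_prop) (by fun_prop)]
    exact Measure.map_id
  conv_rhs => rw [← this, lintegral_map hg (by fun_prop)]

/-- The expectation of `f 0 (z 0) * ⋯ * f (n - 1) (z (n - 1)) * h (z n)` for the Markov chain with
kernels `κ`, as a function of the initial state. -/
def chainExp (κ : ℕ → Kernel E E) : ℕ → (ℕ → E → ℝ≥0∞) → (E → ℝ≥0∞) → E → ℝ≥0∞
  | 0, _, h => h
  | n + 1, f, h => chainExp κ n f fun x => f n x * ∫⁻ y, h y ∂(κ n x)

theorem measurable_chainExp (κ : ℕ → Kernel E E) (n : ℕ) {f : ℕ → E → ℝ≥0∞}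
    (hf : ∀ n, Measurable (f n)) {h : E → ℝ≥0∞} (hh : Measurable h) :
    Measurable (chainExp κ n f h) := by
  induction n generalizing h with
  | zero => exact hh
  | succ n ih => exact ih ((hf n).mul hh.lintegral_kernel)

/-- The definition peels off the last step. Inductions over the past of a site need to peel off the
first one. -/
theorem chainExp_succ' (κ : ℕ → Kernel E E) (n : ℕ) (f : ℕ → E → ℝ≥0∞) (h : E → ℝ≥0∞) (x : E) :
    chainExp κ (n + 1) f h x =
      f 0 x * ∫⁻ y, chainExp (fun m => κ (m + 1)) n (fun m => f (m + 1)) h y ∂(κ 0 x) := by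
  induction n generalizing h with
  | zero => rfl
  | succ n ih =>
    rw [chainExp, ih]
    rfl

/-- The last variable is integrated out by the Markov property and absorbed into the function of the
one before it. -/
theorem lintegral_chainLaw_prod (μ₀ : Measure E) [IsProbabilityMeasure μ₀] (κ : ℕ → Kernel E E)
    [∀ n, IsMarkovKernel (κ n)] (n : ℕ) {f : ℕ → E → ℝ≥0∞} (hf : ∀ n, Measurable (f n))
    {h : E → ℝ≥0∞} (hh : Measurable h) :
    ∫⁻ z, (∏ s ∈ Finset.range n, f s (z s)) * h (z n) ∂(chainLaw μ₀ κ) =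
      ∫⁻ x, chainExp κ n f h x ∂μ₀ := by
  induction n generalizing h with
  | zero => simpa [chainExp] using lintegral_chainLaw_zero μ₀ κ hh
  | succ n ih =>
    rw [chainExp, ← ih (h := fun x => f n x * ∫⁻ y, h y ∂(κ n x))
      ((hf n).mul hh.lintegral_kernel)]
    have hF : Measurable fun w : Π _ : Finset.Iic n, E =>
        ∏ s : Finset.range (n + 1), f s
          (w ⟨s, Finset.mem_Iic.2 (Nat.lt_succ_iff.1 (Finset.mem_range.1 s.2))⟩) :=
      Finset.measurable_prod _ fun s _ => (hf s).comp (measurable_pi_apply _)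
    have h1 := lintegral_chainLaw_succ μ₀ κ n hF hh
    have h2 : ∀ z : ℕ → E, (∏ s : Finset.range (n + 1), f s
        (Preorder.frestrictLe (π := fun _ => E) n z
          ⟨s, Finset.mem_Iic.2 (Nat.lt_succ_iff.1 (Finset.mem_range.1 s.2))⟩)) =
        ∏ s ∈ Finset.range (n + 1), f s (z s) := fun z => by
      simp only [Preorder.frestrictLe_apply]
      exact Finset.prod_coe_sort (Finset.range (n + 1)) fun s => f s (z s)
    simp only [h2] at h1
    rw [h1]
    refine lintegral_congr fun z => ?_
    rw [Finset.prod_range_succ]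
    ring

/-- Expectations of products over finitely many coordinates factorize under a product measure. -/
theorem lintegral_infinitePi_prod {ι : Type*} {X : ι → Type*} [∀ i, MeasurableSpace (X i)]
    (μ : ∀ i, Measure (X i)) [∀ i, IsProbabilityMeasure (μ i)] (V : Finset ι)
    {F : ∀ i, X i → ℝ≥0∞} (hF : ∀ i, Measurable (F i)) :
    ∫⁻ ζ, ∏ i ∈ V, F i (ζ i) ∂(Measure.infinitePi μ) = ∏ i ∈ V, ∫⁻ z, F i z ∂(μ i) := by
  have h := iIndepFun_infinitePi (P := μ) (X := fun i => F i) fun i => hF i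
  rw [lintegral_prod_eq_prod_lintegral_of_indepFun V _ h fun i => by fun_prop]
  refine Finset.prod_congr rfl fun i _ => ?_
  exact (measurePreserving_eval_infinitePi μ i).lintegral_comp (hF i)

/-- Two finite measures on the sequences in a countable space agree if they agree on the sets of
sequences with prescribed initial segments. -/
theorem ext_of_initialSegments [Countable E] [MeasurableSingletonClass E]
    {μ ν : Measure (ℕ → E)} [IsFiniteMeasure μ]
    (h : ∀ (n : ℕ) (u : ℕ → E), μ {z | ∀ s < n, z s = u s} = ν {z | ∀ s < n, z s = u s}) :
    μ = ν := by
  have key : ∀ n : ℕ, μ.map (Preorder.frestrictLe (π := fun _ => E) n) =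
      ν.map (Preorder.frestrictLe (π := fun _ => E) n) := by
    intro n
    refine Measure.ext_of_singleton fun w => ?_
    rcases isEmpty_or_nonempty E with hE | ⟨⟨e⟩⟩
    · exact (hE.false (w ⟨0, Finset.mem_Iic.2 (Nat.zero_le n)⟩)).elim
    rw [Measure.map_apply (by fun_prop) (measurableSet_singleton _),
      Measure.map_apply (by fun_prop) (measurableSet_singleton _)]
    have : Preorder.frestrictLe (π := fun _ => E) n ⁻¹' {w} = {z | ∀ s < n + 1,
        z s = (fun s => if hs : s ≤ n then w ⟨s, Finset.mem_Iic.2 hs⟩ else e) s} := by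
      ext z
      simp only [Set.mem_preimage, Set.mem_singleton_iff, funext_iff, Set.mem_ofPred_eq,
        Subtype.forall, Finset.mem_Iic, Nat.lt_succ_iff, Preorder.frestrictLe_apply]
      refine forall_congr' fun s => forall_congr' fun hs => ?_
      simp [hs]
    rw [this, h]
  have key' : ∀ (n : ℕ) (S : Set (Π _ : Finset.Iic n, E)), MeasurableSet S →
      μ (Preorder.frestrictLe (π := fun _ => E) n ⁻¹' S) =
        ν (Preorder.frestrictLe (π := fun _ => E) n ⁻¹' S) := fun n S hS => by
    rw [← Measure.map_apply (by fun_prop) hS, key n, Measure.map_apply (by fun_prop) hS]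
  -- Equality of the total masses is part of what has to be checked, and comes from the full set at
  -- level `0`.
  refine ext_of_generate_finite _ (generateFrom_measurableCylinders (α := fun _ : ℕ => E)).symm
    isPiSystem_measurableCylinders (fun t ht => ?_) (key' 0 Set.univ MeasurableSet.univ)
  obtain ⟨N, S, mS, rfl⟩ : ∃ N S, MeasurableSet S ∧
      t = cylinder (α := fun _ : ℕ => E) (Finset.Iic N) S := by
    simpa [measurableCylinders_nat] using ht
  exact key' N S mS

end General

/-! ### From averages along a subsequence of times to averages along all times -/

section Deterministic

variable {V : Type*} [NormedAddCommGroup V] [NormedSpace ℝ V]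

/-- If the averages of a bounded sequence converge along an increasing sequence of times which
grows linearly, then they converge. -/
theorem tendsto_average_of_subsequence {a : ℕ → V} {C : ℝ} (ha : ∀ s, ‖a s‖ ≤ C) {T : ℕ → ℕ}
    (hT0 : T 0 = 0) (hT : StrictMono T) {m : ℝ} (hm : 0 < m) {S : V}
    (h1 : Tendsto (fun k : ℕ => (k : ℝ)⁻¹ * T k) atTop (𝓝 m))
    (h2 : Tendsto (fun k : ℕ => (k : ℝ)⁻¹ • ∑ s ∈ Finset.range (T k), a s) atTop (𝓝 S)) :
    Tendsto (fun n : ℕ => (n : ℝ)⁻¹ • ∑ s ∈ Finset.range n, a s) atTop (𝓝 (m⁻¹ • S)) := by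
  -- The number of blocks completed by time `n`. Searching up to `n` is enough since `T k ≥ k`.
  set k : ℕ → ℕ := fun n => Nat.findGreatest (fun k => T k ≤ n) n with hk
  have hk1 : ∀ n, T (k n) ≤ n := fun n =>
    Nat.findGreatest_spec (P := fun k => T k ≤ n) (Nat.zero_le n) (by simp [hT0])
  have hk2 : ∀ n, n < T (k n + 1) := fun n => by
    by_contra! h
    have := Nat.le_findGreatest (P := fun k => T k ≤ n) ((hT.le_apply (x := k n + 1)).trans h) h
    exact absurd this (by simp [hk])
  have hktop : Tendsto k atTop atTop := by
    refine tendsto_atTop.2 fun b => ?_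
    filter_upwards [eventually_ge_atTop (T b)] with n hn
    exact Nat.le_findGreatest ((hT.le_apply (x := b)).trans hn) hn
  have hkpos : ∀ᶠ n in atTop, (0 : ℝ) < k n := by
    filter_upwards [hktop.eventually_ge_atTop 1] with n hn
    exact_mod_cast hn
  have h1k := h1.comp hktop
  have h1k' : Tendsto (fun n => ((k n : ℝ))⁻¹ * T (k n + 1)) atTop (𝓝 m) := by
    have h3 : Tendsto (fun k : ℕ => ((k : ℝ) + 1) / k) atTop (𝓝 1) := by
      have : Tendsto (fun k : ℕ => 1 + ((k : ℝ))⁻¹) atTop (𝓝 (1 + 0)) :=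
        tendsto_const_nhds.add tendsto_inv_atTop_nhds_zero_nat
      rw [add_zero] at this
      refine this.congr' ?_
      filter_upwards [eventually_ge_atTop 1] with n hn
      have : (n : ℝ) ≠ 0 := by positivity
      field_simp
    have h4 : Tendsto (fun k : ℕ => (k : ℝ)⁻¹ * T (k + 1)) atTop (𝓝 m) := by
      have h5 := h3.mul (h1.comp (tendsto_add_atTop_nat 1))
      rw [one_mul] at h5
      refine h5.congr fun n => ?_
      have : (n : ℝ) + 1 ≠ 0 := by positivity
      simp only [Function.comp_apply, Nat.cast_add, Nat.cast_one]
      field_simp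
    exact h4.comp hktop
  have hn : Tendsto (fun n => ((k n : ℝ))⁻¹ * n) atTop (𝓝 m) := by
    refine tendsto_of_tendsto_of_tendsto_of_le_of_le h1k h1k' (fun n => ?_) (fun n => ?_)
    · have : (T (k n) : ℝ) ≤ n := by exact_mod_cast hk1 n
      simp only [Function.comp_apply]; gcongr
    · have : (n : ℝ) ≤ T (k n + 1) := by exact_mod_cast (hk2 n).le
      dsimp only; gcongr
  have hA : Tendsto (fun n => ((k n : ℝ))⁻¹ • ∑ s ∈ Finset.range n, a s) atTop (𝓝 S) := by
    -- The incomplete block contributes at most `C * (n - T (k n))`, which is `o(k n)` because both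
    -- `n` and `T (k n)` are asymptotic to `m * k n`.
    have h0 : Tendsto (fun n => ((k n : ℝ))⁻¹ •
        (∑ s ∈ Finset.range n, a s - ∑ s ∈ Finset.range (T (k n)), a s)) atTop (𝓝 0) := by
      have hz : Tendsto (fun n => C * (((k n : ℝ))⁻¹ * n - ((k n : ℝ))⁻¹ * T (k n))) atTop
          (𝓝 0) := by
        simpa using (hn.sub h1k).const_mul C
      refine squeeze_zero_norm (fun n => ?_) hz
      rw [Finset.sum_range_sub_sum_range (hk1 n), norm_smul, norm_inv, Real.norm_natCast]
      have h6 : ‖∑ s ∈ Finset.range n with T (k n) ≤ s, a s‖ ≤ C * (n - T (k n)) := by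
        refine (norm_sum_le_of_le _ fun s _ => ha s).trans ?_
        have : (Finset.range n).filter (fun s => T (k n) ≤ s) = Finset.Ico (T (k n)) n := by
          ext; simp [and_comm]
        rw [this, Finset.sum_const, Nat.card_Ico, nsmul_eq_mul, Nat.cast_sub (hk1 n), mul_comm]
      calc ((k n : ℝ))⁻¹ * _ ≤ ((k n : ℝ))⁻¹ * (C * (n - T (k n))) := by gcongr
        _ = _ := by ring
    have := h0.add (h2.comp hktop)
    rw [zero_add] at this
    refine this.congr fun n => ?_
    simp [smul_sub]
  have := (hn.inv₀ hm.ne').smul hA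
  refine this.congr' ?_
  filter_upwards [hkpos] with n hn
  rw [smul_smul]
  congr 1
  field_simp

end Deterministic

/-! ### Renewal sequences: independent blocks and their law of large numbers -/

section Renewal

/-- Transports the independence of the first block from the later ones to the `i`-th block, by
shifting over `i` blocks. -/
theorem indepFun_comp_measurePreserving {A B Ω : Type*} [MeasurableSpace A] [MeasurableSpace B]
    [MeasurableSpace Ω] {ν : Measure Ω} {T : Ω → Ω} (hT : MeasurePreserving T ν ν) {f : Ω → A}
    {g : Ω → B} (hf : Measurable f) (hg : Measurable g) (h : IndepFun f g ν) :
    IndepFun (f ∘ T) (g ∘ T) ν := by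
  rw [indepFun_iff_measure_inter_preimage_eq_mul] at h ⊢
  intro s t hs ht
  have h1 := hT.measure_preimage (hf hs).nullMeasurableSet
  have h2 := hT.measure_preimage (hg ht).nullMeasurableSet
  have h3 := hT.measure_preimage ((hf hs).inter (hg ht)).nullMeasurableSet
  rw [Set.preimage_comp, Set.preimage_comp, ← Set.preimage_inter, h3, h1, h2, h s t hs ht]

variable {U : Type*} [MeasurableSpace U]

/-- The sequences which agree with `u` up to time `n`, exclusive. -/
def segment (n : ℕ) (u : ℕ → U) : Set (ℕ → U) := {z | ∀ s < n, z s = u s}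

/-- The shift by `n` of a sequence. -/
def shiftSeq (n : ℕ) (z : ℕ → U) : ℕ → U := fun s => z (n + s)

theorem measurable_shiftSeq (n : ℕ) : Measurable (shiftSeq n : (ℕ → U) → ℕ → U) :=
  measurable_pi_lambda _ fun _ => measurable_pi_apply _

theorem measurableSet_segment [MeasurableSingletonClass U] (n : ℕ) (u : ℕ → U) :
    MeasurableSet (segment n u) := by
  have : segment n u = ⋂ s, ⋂ (_ : s < n), (fun z => z s) ⁻¹' {u s} := by
    ext; simp [segment]
  rw [this]
  exact .iInter fun s => .iInter fun _ => measurable_pi_apply s (measurableSet_singleton _)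

/-- A set of sequences which depends on the first `n` terms only. -/
def DeterminedBy (n : ℕ) (A : Set (ℕ → U)) : Prop :=
  ∀ ⦃z z'⦄, (∀ s < n, z s = z' s) → z ∈ A → z' ∈ A

/-- A set of sequences depending on the first `n` terms is a disjoint union of segments. -/
theorem DeterminedBy.exists_segments {n : ℕ} {A : Set (ℕ → U)} (hA : DeterminedBy n A) :
    ∃ (B : Set (Fin n → U)) (v : B → ℕ → U), (∀ i, v i ∈ A) ∧
      A = ⋃ i, segment n (v i) ∧ Pairwise (Function.onFun Disjoint fun i => segment n (v i)) := by
  let r : (ℕ → U) → Fin n → U := fun z s => z s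
  refine ⟨r '' A, fun w => w.2.choose, fun w => w.2.choose_spec.1, ?_, ?_⟩
  · ext z
    simp only [Set.mem_iUnion]
    constructor
    · intro hz
      have h : r z ∈ r '' A := ⟨z, hz, rfl⟩
      refine ⟨⟨r z, h⟩, fun s hs => ?_⟩
      exact (congrFun h.choose_spec.2 ⟨s, hs⟩).symm
    · rintro ⟨w, hz⟩
      exact hA (fun s hs => (hz s hs).symm) w.2.choose_spec.1
  · intro w w' hne
    refine Set.disjoint_left.2 fun z hz hz' => hne (Subtype.ext ?_)
    rw [← w.2.choose_spec.2, ← w'.2.choose_spec.2]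
    funext s
    exact (hz s s.2).symm.trans (hz' s s.2)

theorem DeterminedBy.measurableSet [Countable U] [MeasurableSingletonClass U] {n : ℕ}
    {A : Set (ℕ → U)} (hA : DeterminedBy n A) : MeasurableSet A := by
  obtain ⟨B, v, -, h, -⟩ := hA.exists_segments
  rw [h]
  exact .iUnion fun i => measurableSet_segment n _

/-- A law of sequences which starts afresh after each visit to `D`. -/
def RenewsAt (μ : Measure (ℕ → U)) (D : Set U) : Prop :=
  ∀ (t n : ℕ) (u : ℕ → U), u t ∈ D →
    μ (segment (t + 1 + n) u) = μ (segment (t + 1) u) * μ (segment n (shiftSeq (t + 1) u))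

variable [Countable U] [MeasurableSingletonClass U] {μ : Measure (ℕ → U)} [IsProbabilityMeasure μ]
  {D : Set U}

/-- As functions of `F`, both sides are finite measures, so it suffices to compare them on segments,
where the renewal property applies. -/
theorem RenewsAt.segment_inter (h : RenewsAt μ D) {t : ℕ} {u : ℕ → U} (hu : u t ∈ D)
    {F : Set (ℕ → U)} (hF : MeasurableSet F) :
    μ (segment (t + 1) u ∩ shiftSeq (t + 1) ⁻¹' F) = μ (segment (t + 1) u) * μ F := by
  have : (μ.restrict (segment (t + 1) u)).map (shiftSeq (t + 1)) = μ (segment (t + 1) u) • μ := by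
    refine ext_of_initialSegments fun n w => ?_
    change _ = (μ (segment (t + 1) u) • μ) (segment n w)
    have hmeas : MeasurableSet {z : ℕ → U | ∀ s < n, z s = w s} := measurableSet_segment n w
    rw [Measure.map_apply (measurable_shiftSeq _) hmeas,
      Measure.restrict_apply (measurable_shiftSeq _ hmeas), Measure.smul_apply, smul_eq_mul]
    -- The concatenation of the past `u` and the future `w`.
    let u' : ℕ → U := fun s => if s < t + 1 then u s else w (s - (t + 1))
    have h1 := h t n u' (by simpa [u'] using hu)
    have h2 : segment (t + 1) u' = segment (t + 1) u := by
      ext z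
      refine forall_congr' fun s => forall_congr' fun hs => ?_
      simp only [u', if_pos hs]
    have h3 : shiftSeq (t + 1) u' = w := by
      funext s
      simp [u', shiftSeq, show ¬ t + 1 + s ≤ t by omega]
    rw [h2, h3] at h1
    rw [← h1]
    congr 1
    ext z
    simp only [Set.mem_inter_iff, Set.mem_preimage, segment, Set.mem_ofPred_eq, shiftSeq, u']
    constructor
    · rintro ⟨ha, hb⟩ s hs
      split_ifs with hst
      · exact hb s hst
      · have := ha (s - (t + 1)) (by omega)
        rwa [Nat.add_sub_cancel' (by omega)] at this
    · intro ha
      refine ⟨fun s hs => ?_, fun s hs => ?_⟩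
      · simpa [show ¬ t + 1 + s ≤ t by omega] using ha (t + 1 + s) (by omega)
      · simpa only [if_pos hs] using ha s (by omega)
  rw [Set.inter_comm, ← Measure.restrict_apply (measurable_shiftSeq _ hF),
    ← Measure.map_apply (measurable_shiftSeq _) hF, this, Measure.smul_apply, smul_eq_mul]

theorem RenewsAt.inter (h : RenewsAt μ D) {t : ℕ} {A : Set (ℕ → U)} (hA : DeterminedBy (t + 1) A)
    (hAD : ∀ z ∈ A, z t ∈ D) {F : Set (ℕ → U)} (hF : MeasurableSet F) :
    μ (A ∩ shiftSeq (t + 1) ⁻¹' F) = μ A * μ F := by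
  obtain ⟨B, v, hv, hU, hd⟩ := hA.exists_segments
  rw [hU, Set.iUnion_inter, measure_iUnion, measure_iUnion hd fun i => measurableSet_segment _ _,
    ← ENNReal.tsum_mul_right]
  · exact tsum_congr fun i => h.segment_inter (hAD _ (hv i)) hF
  · intro i j hij
    exact (hd hij).mono Set.inter_subset_left Set.inter_subset_left
  · exact fun i => (measurableSet_segment _ _).inter (measurable_shiftSeq _ hF)

/-- The time at which a sequence has just made its first visit to `D`. -/
def blockLength (D : Set U) (z : ℕ → U) : ℕ := sInf {n | z n ∈ D} + 1

/-- The sequence after the first visit to `D`. -/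
def nextBlock (D : Set U) (z : ℕ → U) : ℕ → U := shiftSeq (blockLength D z) z

/-- The sequences whose first visit to `D` is at time `n`. -/
def firstVisit (D : Set U) (n : ℕ) : Set (ℕ → U) := {z | z n ∈ D ∧ ∀ m < n, z m ∉ D}

theorem determinedBy_firstVisit (D : Set U) (n : ℕ) : DeterminedBy (n + 1) (firstVisit D n) := by
  rintro z z' h ⟨h1, h2⟩
  exact ⟨h n (by omega) ▸ h1, fun m hm => h m (by omega) ▸ h2 m hm⟩

theorem blockLength_of_mem_firstVisit {n : ℕ} {z : ℕ → U} (hz : z ∈ firstVisit D n) :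
    blockLength D z = n + 1 := by
  have : IsLeast {n | z n ∈ D} n := ⟨hz.1, fun m hm => not_lt.1 fun h => hz.2 m h hm⟩
  rw [blockLength, this.csInf_eq]

theorem exists_mem_firstVisit {z : ℕ → U} (hz : ∃ n, z n ∈ D) : ∃ n, z ∈ firstVisit D n := by
  classical
  exact ⟨Nat.find hz, Nat.find_spec hz, fun m hm => Nat.find_min hz hm⟩

theorem disjoint_firstVisit (D : Set U) :
    Pairwise (Function.onFun Disjoint fun n => firstVisit D n) := fun m n hmn =>
  Set.disjoint_left.2 fun z hz hz' => hmn (by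
    have := (blockLength_of_mem_firstVisit hz).symm.trans (blockLength_of_mem_firstVisit hz')
    omega)

theorem measurable_blockLength (D : Set U) : Measurable (blockLength D) := by
  have h : ∀ n : ℕ, MeasurableSet (firstVisit D n) :=
    fun n => (determinedBy_firstVisit D n).measurableSet
  refine measurable_to_countable' fun k => ?_
  -- A sequence that never visits `D` has block length `1`, since `sInf ∅ = 0`. Hence the extra
  -- piece at `k = 1`.
  have : blockLength D ⁻¹' {k} =
      (⋃ n, ⋃ (_ : n + 1 = k), firstVisit D n) ∪
        (if k = 1 then (⋃ n, firstVisit D n)ᶜ else ∅) := by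
    ext z
    simp only [Set.mem_preimage, Set.mem_singleton_iff, Set.mem_union, Set.mem_iUnion]
    by_cases hz : ∃ n, z n ∈ D
    · obtain ⟨n, hn⟩ := exists_mem_firstVisit hz
      have hnot : z ∉ (if k = 1 then (⋃ n, firstVisit D n)ᶜ else ∅) := by
        split_ifs
        · simpa using ⟨n, hn⟩
        · simp
      simp only [hnot, or_false, blockLength_of_mem_firstVisit hn]
      constructor
      · exact fun h => ⟨n, h, hn⟩
      · rintro ⟨m, rfl, hm⟩
        rw [← blockLength_of_mem_firstVisit hn, blockLength_of_mem_firstVisit hm]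
    · push Not at hz
      have h1 : blockLength D z = 1 := by simp [blockLength, hz]
      have h2 : ∀ n, z ∉ firstVisit D n := fun n h => hz n h.1
      rw [h1]
      by_cases hk : k = 1
      · simp [hk, h2]
      · simp [hk, h2, Ne.symm hk]
  rw [this]
  refine .union (.iUnion fun n => .iUnion fun _ => h n) ?_
  split_ifs
  · exact (MeasurableSet.iUnion h).compl
  · exact .empty

theorem measurable_nextBlock (D : Set U) : Measurable (nextBlock D) := by
  have : Measurable fun w : ℕ × (ℕ → U) => shiftSeq w.1 w.2 :=
    measurable_from_prod_countable_right fun n => measurable_shiftSeq n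
  exact this.comp ((measurable_blockLength D).prodMk measurable_id)

variable {V : Type*} [NormedAddCommGroup V] [NormedSpace ℝ V] [MeasurableSpace V] [BorelSpace V]
  [SecondCountableTopology V]

/-- The sum of a functional over the first block. -/
def blockSum (D : Set U) (f : U → V) (z : ℕ → U) : V := ∑ s ∈ Finset.range (blockLength D z), f (z s)

theorem measurable_blockSum (D : Set U) (f : U → V) : Measurable (blockSum D f) := by
  have : Measurable fun w : ℕ × (ℕ → U) => ∑ s ∈ Finset.range w.1, f (w.2 s) :=
    measurable_from_prod_countable_right fun n => by
      exact Finset.measurable_sum (Finset.range n) fun s _ =>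
        (measurable_of_countable f).comp (measurable_pi_apply s : Measurable fun z : ℕ → U => z s)
  exact this.comp ((measurable_blockLength D).prodMk measurable_id)

/-- The first block is independent of the sequence that follows it, which has the same law as the
whole sequence. -/
theorem RenewsAt.block_inter (h : RenewsAt μ D) (hD : ∀ᵐ z ∂μ, ∃ n, z n ∈ D) (f : U → V)
    (C : Set (ℕ × V)) {F : Set (ℕ → U)} (hF : MeasurableSet F) :
    μ ((fun z => (blockLength D z, blockSum D f z)) ⁻¹' C ∩ nextBlock D ⁻¹' F) =
      μ ((fun z => (blockLength D z, blockSum D f z)) ⁻¹' C) * μ F := by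
  set ξ : (ℕ → U) → ℕ × V := fun z => (blockLength D z, blockSum D f z)
  -- If the first visit is at time `n`, the block is read off from the terms `0, …, n`, so the
  -- renewal property at time `n` applies to each piece.
  have hdet : ∀ n, DeterminedBy (n + 1) (ξ ⁻¹' C ∩ firstVisit D n) := by
    rintro n z z' hzz ⟨h1, h2⟩
    have h2' := determinedBy_firstVisit D n hzz h2
    refine ⟨?_, h2'⟩
    have : ξ z' = ξ z := by
      simp only [ξ, blockSum, blockLength_of_mem_firstVisit h2,
        blockLength_of_mem_firstVisit h2']
      congr 1
      refine Finset.sum_congr rfl fun s hs => ?_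
      rw [hzz s (Finset.mem_range.1 hs)]
    rwa [Set.mem_preimage, this]
  have hsplit : ∀ G : Set (ℕ → U), (∀ n, MeasurableSet (G ∩ firstVisit D n)) →
      μ G = ∑' n, μ (G ∩ firstVisit D n) := by
    intro G hG
    rw [← measure_iUnion _ hG, ← Set.inter_iUnion]
    · refine (measure_congr ?_).symm
      filter_upwards [hD] with z hz
      obtain ⟨n, hn⟩ := exists_mem_firstVisit hz
      exact propext ⟨fun h => h.1, fun h => ⟨h, Set.mem_iUnion.2 ⟨n, hn⟩⟩⟩
    · exact fun i j hij => (disjoint_firstVisit D hij).mono Set.inter_subset_right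
        Set.inter_subset_right
  have hinter : ∀ n, ξ ⁻¹' C ∩ nextBlock D ⁻¹' F ∩ firstVisit D n =
      ξ ⁻¹' C ∩ firstVisit D n ∩ shiftSeq (n + 1) ⁻¹' F := by
    intro n
    ext z
    simp only [Set.mem_inter_iff, Set.mem_preimage, nextBlock]
    constructor
    · rintro ⟨⟨h1, h2⟩, h3⟩
      exact ⟨⟨h1, h3⟩, blockLength_of_mem_firstVisit h3 ▸ h2⟩
    · rintro ⟨⟨h1, h3⟩, h2⟩
      exact ⟨⟨h1, (blockLength_of_mem_firstVisit h3).symm ▸ h2⟩, h3⟩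
  rw [hsplit _ fun n => by
      rw [hinter]; exact (hdet n).measurableSet.inter (measurable_shiftSeq _ hF),
    hsplit _ fun n => (hdet n).measurableSet, ← ENNReal.tsum_mul_right]
  refine tsum_congr fun n => ?_
  rw [hinter, h.inter (hdet n) (fun z hz => hz.2.1) hF]

theorem RenewsAt.measurePreserving_nextBlock (h : RenewsAt μ D) (hD : ∀ᵐ z ∂μ, ∃ n, z n ∈ D) :
    MeasurePreserving (nextBlock D) μ μ := by
  refine ⟨measurable_nextBlock D, Measure.ext fun F hF => ?_⟩
  rw [Measure.map_apply (measurable_nextBlock D) hF]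
  simpa using h.block_inter hD (fun _ => (0 : ℝ)) Set.univ hF

theorem RenewsAt.indepFun_block (h : RenewsAt μ D) (hD : ∀ᵐ z ∂μ, ∃ n, z n ∈ D) (f : U → V) :
    IndepFun (fun z => (blockLength D z, blockSum D f z)) (nextBlock D) μ := by
  rw [indepFun_iff_measure_inter_preimage_eq_mul]
  intro C F _ hF
  rw [h.block_inter hD f C hF, (h.measurePreserving_nextBlock hD).measure_preimage
    hF.nullMeasurableSet]

/-- The strong law of large numbers for a functional of the blocks. -/
theorem RenewsAt.strong_law_blocks {W : Type*} [NormedAddCommGroup W] [NormedSpace ℝ W]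
    [CompleteSpace W] [MeasurableSpace W] [BorelSpace W] (h : RenewsAt μ D)
    (hD : ∀ᵐ z ∂μ, ∃ n, z n ∈ D) (f : U → V) {φ : ℕ × V → W} (hφ : Measurable φ)
    (hint : Integrable (fun z => φ (blockLength D z, blockSum D f z)) μ) :
    ∀ᵐ z ∂μ, Tendsto (fun k : ℕ => (k : ℝ)⁻¹ • ∑ i ∈ Finset.range k,
      φ (blockLength D ((nextBlock D)^[i] z), blockSum D f ((nextBlock D)^[i] z))) atTop
      (𝓝 (∫ z, φ (blockLength D z, blockSum D f z) ∂μ)) := by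
  set ξ : (ℕ → U) → ℕ × V := fun z => (blockLength D z, blockSum D f z)
  have hξ : Measurable ξ := (measurable_blockLength D).prodMk (measurable_blockSum D f)
  have hmp := h.measurePreserving_nextBlock hD
  have hlt : ∀ i j, i < j → IndepFun (fun z => φ (ξ ((nextBlock D)^[i] z)))
      (fun z => φ (ξ ((nextBlock D)^[j] z))) μ := by
    intro i j hij
    obtain ⟨k, rfl⟩ := Nat.exists_eq_add_of_lt hij
    have h1 : IndepFun (φ ∘ ξ) (φ ∘ ξ ∘ (nextBlock D)^[k] ∘ nextBlock D) μ :=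
      (h.indepFun_block hD f).comp (φ := φ) (ψ := φ ∘ ξ ∘ (nextBlock D)^[k]) hφ
        (hφ.comp (hξ.comp ((measurable_nextBlock D).iterate k)))
    have h2 := indepFun_comp_measurePreserving (hmp.iterate i) (hφ.comp hξ)
      (hφ.comp (hξ.comp (((measurable_nextBlock D).iterate k).comp (measurable_nextBlock D)))) h1
    have h3 : (fun z => φ (ξ ((nextBlock D)^[i + k + 1] z))) =
        (φ ∘ ξ ∘ (nextBlock D)^[k] ∘ nextBlock D) ∘ (nextBlock D)^[i] := by
      rw [show i + k + 1 = (k + 1) + i by omega, Function.iterate_add, Function.iterate_succ]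
      rfl
    rw [h3]
    exact h2
  -- This form of the strong law needs only pairwise independence and identical distribution.
  refine strong_law_ae (fun i z => φ (ξ ((nextBlock D)^[i] z))) (by simpa using hint) ?_ ?_
  · intro i j hij
    rcases lt_or_gt_of_ne hij with hlt' | hlt'
    · exact hlt i j hlt'
    · exact (hlt j i hlt').symm
  · intro i
    refine ⟨?_, ?_, ?_⟩
    · exact (hφ.comp (hξ.comp ((measurable_nextBlock D).iterate i))).aemeasurable
    · exact (hφ.comp hξ).aemeasurable
    · change μ.map ((φ ∘ ξ) ∘ (nextBlock D)^[i]) = μ.map (φ ∘ ξ)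
      rw [← Measure.map_map (hφ.comp hξ) ((measurable_nextBlock D).iterate i), (hmp.iterate i).map_eq]

/-- The time at which the first `k` blocks are completed. -/
def blocksEnd (D : Set U) (z : ℕ → U) (k : ℕ) : ℕ :=
  ∑ i ∈ Finset.range k, blockLength D ((nextBlock D)^[i] z)

/-- Locates the successive blocks inside the original sequence, so that sums over blocks become sums
over time. -/
theorem iterate_nextBlock (D : Set U) (z : ℕ → U) (k : ℕ) :
    (nextBlock D)^[k] z = shiftSeq (blocksEnd D z k) z := by
  induction k with
  | zero => funext s; simp [blocksEnd, shiftSeq]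
  | succ k ih =>
    rw [Function.iterate_succ_apply', nextBlock, blocksEnd, Finset.sum_range_succ, ← blocksEnd]
    conv_lhs => rw [ih]
    rw [ih]
    funext s
    simp [shiftSeq, add_assoc]

theorem sum_range_blocksEnd (D : Set U) (f : U → V) (z : ℕ → U) (k : ℕ) :
    ∑ s ∈ Finset.range (blocksEnd D z k), f (z s) =
      ∑ i ∈ Finset.range k, blockSum D f ((nextBlock D)^[i] z) := by
  induction k with
  | zero => simp [blocksEnd]
  | succ k ih =>
    rw [Finset.sum_range_succ, ← ih, blocksEnd, Finset.sum_range_succ, ← blocksEnd,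
      Finset.sum_range_add, blockSum]
    congr 1
    refine Finset.sum_congr rfl fun s _ => ?_
    conv_rhs => rw [iterate_nextBlock]
    rfl

theorem integrable_blockSum (hσ : Integrable (fun z => (blockLength D z : ℝ)) μ) {f : U → V} {C : ℝ}
    (hf : ∀ u, ‖f u‖ ≤ C) : Integrable (blockSum D f) μ := by
  refine (hσ.mul_const C).mono' (measurable_blockSum D f).aestronglyMeasurable (ae_of_all _ fun z => ?_)
  refine (norm_sum_le_of_le _ fun s _ => hf (z s)).trans ?_
  simp

/-- **Renewal law of large numbers.** -/
theorem RenewsAt.tendsto_average [CompleteSpace V] (h : RenewsAt μ D) (hD : ∀ᵐ z ∂μ, ∃ n, z n ∈ D)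
    (hσ : Integrable (fun z => (blockLength D z : ℝ)) μ) {f : U → V} {C : ℝ}
    (hf : ∀ u, ‖f u‖ ≤ C) :
    ∀ᵐ z ∂μ, Tendsto (fun n : ℕ => (n : ℝ)⁻¹ • ∑ s ∈ Finset.range n, f (z s)) atTop
      (𝓝 ((∫ z, (blockLength D z : ℝ) ∂μ)⁻¹ • ∫ z, blockSum D f z ∂μ)) := by
  have hm : 0 < ∫ z, (blockLength D z : ℝ) ∂μ := by
    have : (1 : ℝ) ≤ ∫ z, (blockLength D z : ℝ) ∂μ := by
      have := integral_mono (μ := μ) (integrable_const (1 : ℝ)) hσ fun z => by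
        simp [blockLength]
      simpa using this
    linarith
  have h1 := h.strong_law_blocks hD f (φ := fun w => (w.1 : ℝ)) (by fun_prop) hσ
  have h2 := h.strong_law_blocks hD f (φ := fun w => w.2) (by fun_prop)
    (integrable_blockSum hσ hf)
  filter_upwards [h1, h2] with z h1 h2
  refine tendsto_average_of_subsequence (a := fun s => f (z s)) (fun s => hf _)
    (T := blocksEnd D z) (by simp [blocksEnd]) ?_ hm ?_ ?_
  · refine strictMono_nat_of_lt_succ fun k => ?_
    rw [blocksEnd, blocksEnd, Finset.sum_range_succ]
    simp [blockLength]
  · refine h1.congr fun k => ?_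
    simp [blocksEnd]
  · refine h2.congr fun k => ?_
    rw [sum_range_blocksEnd]

end Renewal

/-! ### Foster's criterion -/

section Drift

variable {U : Type*} [MeasurableSpace U] [Countable U] [MeasurableSingletonClass U]
  {μ : Measure (ℕ → U)} [IsProbabilityMeasure μ]

/-- The sequences which avoid `D` up to time `t`, inclusive. -/
def avoiding (D : Set U) (t : ℕ) : Set (ℕ → U) := {z | ∀ m ≤ t, z m ∉ D}

theorem measurableSet_avoiding (D : Set U) (t : ℕ) : MeasurableSet (avoiding D t) :=
  DeterminedBy.measurableSet (n := t + 1) fun _ _ h hz m hm => h m (by omega) ▸ hz m hm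

/-- The inequality of a negative drift away from the zeros of `N`. -/
def HasDrift (μ : Measure (ℕ → U)) (N : U → ℕ) (δ : ℝ≥0∞) : Prop :=
  ∀ (t : ℕ) (u : ℕ → U), N (u t) ≠ 0 →
    ∫⁻ z in segment (t + 1) u, (N (z (t + 1)) : ℝ≥0∞) ∂μ + δ * μ (segment (t + 1) u) ≤
      N (u t) * μ (segment (t + 1) u)

/-- The event of avoiding the zeros of `N` up to time `t` splits into segments ending where `N ≠ 0`.
The drift inequality is summed over them. -/
theorem HasDrift.avoiding_step {N : U → ℕ} {δ : ℝ≥0∞} (h : HasDrift μ N δ) (t : ℕ) :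
    ∫⁻ z in avoiding {u | N u = 0} (t + 1), (N (z (t + 1)) : ℝ≥0∞) ∂μ +
        δ * μ (avoiding {u | N u = 0} t) ≤
      ∫⁻ z in avoiding {u | N u = 0} t, (N (z t) : ℝ≥0∞) ∂μ := by
  have hdet : DeterminedBy (t + 1) (avoiding {u | N u = 0} t) :=
    fun _ _ h hz m hm => h m (by omega) ▸ hz m hm
  have hsub : avoiding {u | N u = 0} (t + 1) ⊆ avoiding {u | N u = 0} t :=
    fun z hz m hm => hz m (by omega)
  refine (add_le_add_left (lintegral_mono_set hsub) _).trans ?_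
  obtain ⟨B, v, hv, hU, hd⟩ := hdet.exists_segments
  have hm := fun i => measurableSet_segment (t + 1) (v i)
  rw [hU, lintegral_iUnion hm hd, lintegral_iUnion hm hd, measure_iUnion hd hm,
    ← ENNReal.tsum_mul_left, ← ENNReal.tsum_add]
  refine ENNReal.tsum_le_tsum fun i => (h t (v i) (hv i t le_rfl)).trans_eq ?_
  rw [← setLIntegral_const]
  refine setLIntegral_congr_fun (hm i) fun z hz => ?_
  simp only [hz t (Nat.lt_succ_self t)]

/-- Telescoping: every further step without a zero of `N` costs `δ`, and the initial supply is the
mean of `N` at time `0`. -/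
theorem HasDrift.sum_avoiding_le {N : U → ℕ} {δ : ℝ≥0∞} (h : HasDrift μ N δ) :
    δ * ∑' t, μ (avoiding {u | N u = 0} t) ≤ ∫⁻ z, (N (z 0) : ℝ≥0∞) ∂μ := by
  have key : ∀ n, ∫⁻ z in avoiding {u | N u = 0} n, (N (z n) : ℝ≥0∞) ∂μ +
      δ * ∑ t ∈ Finset.range n, μ (avoiding {u | N u = 0} t) ≤ ∫⁻ z, (N (z 0) : ℝ≥0∞) ∂μ := by
    intro n
    induction n with
    | zero => simpa using setLIntegral_le_lintegral _ _
    | succ n ih =>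
      rw [Finset.sum_range_succ, mul_add, add_comm (δ * _), ← add_assoc]
      exact (add_le_add_left (h.avoiding_step n) _).trans ih
  rw [← ENNReal.tsum_mul_left]
  refine ENNReal.tsum_le_of_sum_range_le fun n => ?_
  rw [← Finset.mul_sum]
  exact le_add_self.trans (key n)

/-- **Foster's criterion**: under a negative drift the first block has finite expectation. -/
theorem HasDrift.integrable_blockLength {N : U → ℕ} {δ : ℝ≥0∞} (h : HasDrift μ N δ) (hδ : δ ≠ 0)
    (h0 : ∫⁻ z, (N (z 0) : ℝ≥0∞) ∂μ ≠ ∞) :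
    (∀ᵐ z ∂μ, ∃ n, z n ∈ {u | N u = 0}) ∧
      Integrable (fun z => (blockLength {u | N u = 0} z : ℝ)) μ := by
  set D : Set U := {u | N u = 0}
  have hsum : ∑' t, μ (avoiding D t) ≠ ∞ := fun htop => by
    have := h.sum_avoiding_le
    rw [htop, ENNReal.mul_top hδ] at this
    exact h0 (top_le_iff.1 this)
  -- Tail-sum formula: with first visit at `n`, exactly the times `t < n` are spent avoiding `D`,
  -- and the block has length `n + 1`.
  have hle : ∀ z : ℕ → U, (∃ n, z n ∈ D) →
      (blockLength D z : ℝ≥0∞) ≤ 1 + ∑' t, (avoiding D t).indicator 1 z := by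
    intro z hz
    obtain ⟨n, hn⟩ := exists_mem_firstVisit hz
    rw [blockLength_of_mem_firstVisit hn]
    have h1 : ∑ t ∈ Finset.range n, (avoiding D t).indicator (1 : (ℕ → U) → ℝ≥0∞) z = n := by
      rw [Finset.sum_congr rfl (g := fun _ => 1) fun t ht => ?_]
      · simp
      · rw [Set.indicator_of_mem]
        · rfl
        · exact fun m hm => hn.2 m (hm.trans_lt (Finset.mem_range.1 ht))
    push_cast
    rw [add_comm, ← h1]
    gcongr
    exact ENNReal.sum_le_tsum _
  have hae : ∀ᵐ z ∂μ, ∃ n, z n ∈ D := by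
    rw [ae_iff]
    have hsub : ∀ t, {z : ℕ → U | ¬ ∃ n, z n ∈ D} ⊆ avoiding D t :=
      fun t z hz m _ hm => hz ⟨m, hm⟩
    have h2 := ENNReal.tendsto_atTop_zero_of_tsum_ne_top hsum
    exact le_antisymm (ge_of_tendsto' h2 fun t => measure_mono (hsub t)) zero_le
  refine ⟨hae, ⟨(measurable_from_nat.comp
    (measurable_blockLength D)).aestronglyMeasurable, ?_⟩⟩
  rw [hasFiniteIntegral_iff_enorm]
  calc ∫⁻ z, ‖(blockLength D z : ℝ)‖ₑ ∂μ
      ≤ ∫⁻ z, (1 + ∑' t, (avoiding D t).indicator 1 z) ∂μ := by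
        refine lintegral_mono_ae ?_
        filter_upwards [hae] with z hz
        refine le_trans (le_of_eq ?_) (hle z hz)
        rw [← ofReal_norm, Real.norm_natCast, ENNReal.ofReal_natCast]
    _ = 1 + ∑' t, μ (avoiding D t) := by
        rw [lintegral_add_left measurable_const, lintegral_tsum]
        · simp only [lintegral_const, measure_univ, mul_one]
          congr 1
          exact tsum_congr fun t => lintegral_indicator_one (measurableSet_avoiding D t)
        · exact fun t => (measurable_one.indicator (measurableSet_avoiding D t)).aemeasurable
    _ < ∞ := by
        rw [ENNReal.add_lt_top]
        exact ⟨ENNReal.one_lt_top, hsum.lt_top⟩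

end Drift

/-! ### Splitting a kernel by a coin -/

section Residual

variable {E Θ : Type*} [MeasurableSpace E] [MeasurableSpace Θ]

theorem toNNReal_add_toNNReal_symm (c : I) :
    (unitInterval.toNNReal c : ℝ≥0∞) + unitInterval.toNNReal (σ c) = 1 := by
  rw [← ENNReal.coe_add, ← ENNReal.coe_one]
  congr 1
  ext
  simp

/-- A kernel is the mixture of its minorant and of its residual kernel. -/
theorem smul_add_smul_residualKernel (k : Kernel Θ E) [IsMarkovKernel k] (m : Measure E)
    [IsProbabilityMeasure m] (c : I)
    (hmeas : MeasurableSet {w | unitInterval.toNNReal c • m ≤ k w}) {w : Θ}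
    (hw : unitInterval.toNNReal c • m ≤ k w) :
    unitInterval.toNNReal c • m + unitInterval.toNNReal (σ c) • residualKernel k m c w = k w := by
  classical
  rcases lt_or_ge c 1 with hc | hc
  · have hσ : unitInterval.toNNReal (σ c) ≠ 0 := by
      intro h0
      have h1 : ((unitInterval.toNNReal (σ c) : ℝ≥0) : ℝ) = 0 := by rw [h0]; rfl
      have h2 : (c : ℝ) < 1 := hc
      have h3 : (1 : ℝ) - c = 0 := by simpa using h1
      linarith
    have : residualKernel k m c w =
        (unitInterval.toNNReal (σ c))⁻¹ • (k w - unitInterval.toNNReal c • m) := by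
      rw [residualKernel, dif_pos ⟨hc, hmeas⟩]
      change (if unitInterval.toNNReal c • m ≤ k w then _ else _) = _
      rw [if_pos hw]
    rw [this, smul_smul, mul_inv_cancel₀ hσ, one_smul, add_comm]
    exact Measure.sub_add_cancel_of_le hw
  -- Here the residual kernel has weight zero, and a probability measure dominated by another one is
  -- equal to it.
  · have hc1 : c = 1 := le_antisymm c.2.2 hc
    subst hc1
    have hw' : m ≤ k w := by simpa using hw
    have h1 : m = k w := Measure.eq_of_le_of_measure_univ_eq hw' (by simp)
    simpa using h1

/-- The residual is `k w` itself or a multiple of a measure below it. This keeps residual jumps on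
the nearest neighbours. -/
theorem residualKernel_apply_eq_zero (k : Kernel Θ E) [IsMarkovKernel k] (m : Measure E)
    [IsProbabilityMeasure m] (c : I) {w : Θ} {A : Set E} (hA : k w A = 0) :
    residualKernel k m c w A = 0 := by
  classical
  rw [residualKernel]
  split_ifs with h
  · change (if unitInterval.toNNReal c • m ≤ k w then
      (unitInterval.toNNReal (σ c))⁻¹ • (k w - unitInterval.toNNReal c • m) else k w) A = 0
    split_ifs with hw
    · rw [Measure.smul_apply]
      have : (k w - unitInterval.toNNReal c • m) A = 0 :=
        le_antisymm ((Measure.sub_le A).trans_eq hA) zero_le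
      rw [this, smul_zero]
    · exact hA
  · exact hA

theorem lintegral_bernoulli (c : I) (g : Bool → ℝ≥0∞) :
    ∫⁻ a, g a ∂(bernoulliMeasure true false c) =
      unitInterval.toNNReal c * g true + unitInterval.toNNReal (σ c) * g false := by
  rw [bernoulliMeasure_def, lintegral_add_measure, lintegral_smul_measure, lintegral_smul_measure,
    lintegral_dirac, lintegral_dirac]
  rfl

end Residual

/-! ### The environment at one site and its regeneration -/

section OneSite

variable {S : Type*} [MeasurableSpace S] (K : Kernel S S) [IsMarkovKernel K] (π : Measure S)
  [IsProbabilityMeasure π] (κ : I)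

theorem lintegral_coinStep (z : Bool × S) {g : Bool × S → ℝ≥0∞} (hg : Measurable g) :
    ∫⁻ y, g y ∂(coinStep K π κ z) = unitInterval.toNNReal κ * ∫⁻ w, g (true, w) ∂π +
      unitInterval.toNNReal (σ κ) * ∫⁻ w, g (false, w) ∂(residualKernel K π κ z.2) := by
  rw [coinStep, Kernel.lintegral_compProd _ _ _ hg, Kernel.const_apply, lintegral_bernoulli]
  rfl

/-- `K w` dominates `κ π` for all `w`. -/
def Minorized : Prop := ∀ w, unitInterval.toNNReal κ • π ≤ K w

variable {K π κ}

/-- Averaging over the coin turns the mixture of `π` and the residual kernel back into `K`. -/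
theorem lintegral_coinStep_snd (hK : Minorized K π κ) (z : Bool × S) {g : S → ℝ≥0∞}
    (hg : Measurable g) : ∫⁻ y, g y.2 ∂(coinStep K π κ z) = ∫⁻ w, g w ∂(K z.2) := by
  rw [lintegral_coinStep K π κ z (g := fun y => g y.2) (by fun_prop),
    ← smul_add_smul_residualKernel K π κ (by simp [hK _]) (hK z.2),
    lintegral_add_measure, lintegral_smul_measure, lintegral_smul_measure]
  rfl

/-- As long as the coin is not revealed, a step preserves `π`. This is what happens at sites that
are not pending. -/
theorem lintegral_invariant_coinStep (hK : Minorized K π κ) (hπ : K.Invariant π) (a : Bool)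
    {g : S → ℝ≥0∞} (hg : Measurable g) :
    ∫⁻ w, ∫⁻ y, g y.2 ∂(coinStep K π κ (a, w)) ∂π = ∫⁻ w, g w ∂π := by
  simp only [lintegral_coinStep_snd hK _ hg]
  rw [← Measure.lintegral_bind K.measurable.aemeasurable hg.aemeasurable, hπ.def]

theorem coinStep_congr (z z' : Bool × S) (h : z.2 = z'.2) :
    coinStep K π κ z = coinStep K π κ z' := by
  refine Measure.ext_of_lintegral _ fun g hg => ?_
  rw [lintegral_coinStep K π κ z hg, lintegral_coinStep K π κ z' hg, h]

/-- The weight of one step at a site: `w` is the weight of the state, `v` tells whether the site is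
properly visited, and `b` is the sequence of the pending states, which has to follow its rule. -/
def siteWeight (w : ℕ → S → ℝ≥0∞) (v b : ℕ → Bool) (s : ℕ) (z : Bool × S) : ℝ≥0∞ :=
  w s z.2 * if b (s + 1) = (v s || (b s && !z.1)) then 1 else 0

theorem measurable_siteWeight {w : ℕ → S → ℝ≥0∞} (hw : ∀ s, Measurable (w s)) (v b : ℕ → Bool)
    (s : ℕ) : Measurable (siteWeight w v b s) := by
  have h1 : Measurable fun a : Bool => if b (s + 1) = (v s || (b s && !a)) then (1 : ℝ≥0∞) else 0 :=
    measurable_of_countable _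
  exact ((hw s).comp measurable_snd).mul (h1.comp measurable_fst)

variable (K π κ) in
/-- The expected product of the first `n` weights at a site, given the initial state there. -/
def siteExp (n : ℕ) (w : ℕ → S → ℝ≥0∞) (v b : ℕ → Bool) : Bool × S → ℝ≥0∞ :=
  chainExp (fun _ => coinStep K π κ) n (siteWeight w v b) fun _ => 1

theorem siteExp_zero (w : ℕ → S → ℝ≥0∞) (v b : ℕ → Bool) (z : Bool × S) :
    siteExp K π κ 0 w v b z = 1 := rfl

theorem siteExp_succ (n : ℕ) (w : ℕ → S → ℝ≥0∞) (v b : ℕ → Bool) (z : Bool × S) :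
    siteExp K π κ (n + 1) w v b z = siteWeight w v b 0 z *
      ∫⁻ y, siteExp K π κ n (fun s => w (s + 1)) (fun s => v (s + 1)) (fun s => b (s + 1)) y
        ∂(coinStep K π κ z) :=
  chainExp_succ' _ _ _ _ _

theorem measurable_siteExp (n : ℕ) {w : ℕ → S → ℝ≥0∞} (hw : ∀ s, Measurable (w s))
    (v b : ℕ → Bool) : Measurable (siteExp K π κ n w v b) :=
  measurable_chainExp _ _ (measurable_siteWeight hw v b) measurable_const

/-- The rule for pending states ignores the current coin of a non-pending site, and the next step
never reads the old coin. -/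
theorem siteExp_of_not_pending (n : ℕ) (w : ℕ → S → ℝ≥0∞) (v : ℕ → Bool) {b : ℕ → Bool}
    (hb : b 0 = false) (z : Bool × S) :
    siteExp K π κ n w v b z = siteExp K π κ n w v b (false, z.2) := by
  cases n with
  | zero => rfl
  | succ n =>
    rw [siteExp_succ, siteExp_succ, coinStep_congr z (false, z.2) rfl]
    simp [siteWeight, hb]

/-- **Regeneration at a site**: if the site is not pending at time `t`, the future of the weights
at the site is independent of the past, and distributed as if time started at `t`. -/
theorem siteExp_regeneration (hK : Minorized K π κ) (hπ : K.Invariant π) (t n : ℕ)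
    {w : ℕ → S → ℝ≥0∞} (hw : ∀ s, Measurable (w s)) {v b : ℕ → Bool}
    (hv : ∀ s, v s = false → ∃ c, w s = fun _ => c) (hbt : b t = false) :
    (b 0 = false → ∫⁻ x, siteExp K π κ (t + n) w v b (false, x) ∂π =
      (∫⁻ x, siteExp K π κ t w v b (false, x) ∂π) *
        ∫⁻ x, siteExp K π κ n (fun s => w (t + s)) (fun s => v (t + s)) (fun s => b (t + s))
          (false, x) ∂π) ∧
    (b 0 = true → ∀ z, ∫⁻ y, siteExp K π κ (t + n) w v b y ∂(coinStep K π κ z) =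
      (∫⁻ y, siteExp K π κ t w v b y ∂(coinStep K π κ z)) *
        ∫⁻ x, siteExp K π κ n (fun s => w (t + s)) (fun s => v (t + s)) (fun s => b (t + s))
          (false, x) ∂π) := by
  induction t generalizing w v b with
  | zero =>
    refine ⟨fun _ => ?_, fun h => by simp [h] at hbt⟩
    simp [siteExp_zero]
  | succ t ih =>
    obtain ⟨ih1, ih2⟩ := ih (w := fun s => w (s + 1)) (v := fun s => v (s + 1))
      (b := fun s => b (s + 1)) (fun s => hw _) (fun s => hv _) hbt
    simp only [show ∀ s, t + s + 1 = t + 1 + s by omega] at ih1 ih2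
    set Ψ := ∫⁻ x, siteExp K π κ n (fun s => w (t + 1 + s)) (fun s => v (t + 1 + s))
      (fun s => b (t + 1 + s)) (false, x) ∂π with hΨ
    have hm : ∀ k, Measurable (siteExp K π κ k w v b) := fun k => measurable_siteExp k hw v b
    have hm' : ∀ k, Measurable (siteExp K π κ k (fun s => w (s + 1)) (fun s => v (s + 1))
        (fun s => b (s + 1))) := fun k => measurable_siteExp k (fun s => hw _) _ _
    have hpair : ∀ a : Bool, Measurable fun x : S => (a, x) := fun a => by fun_prop
    have hI : ∀ (k : ℕ) (a : Bool), Measurable fun x => ∫⁻ y, siteExp K π κ k (fun s => w (s + 1))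
        (fun s => v (s + 1)) (fun s => b (s + 1)) y ∂(coinStep K π κ (a, x)) := fun k a =>
      ((hm' k).lintegral_kernel (κ := coinStep K π κ)).comp (hpair a)
    rw [show t + 1 + n = t + n + 1 by omega]
    -- The state has law `π`, and the coin `a` leaves the site not pending before the visit at the
    -- current time: either the site was already free or the coin has just released it.
    have fresh : ∀ a, (b 0 && !a) = false → ∫⁻ x, siteExp K π κ (t + n + 1) w v b (a, x) ∂π =
        (∫⁻ x, siteExp K π κ (t + 1) w v b (a, x) ∂π) * Ψ := by
      intro a ha
      simp only [siteExp_succ, siteWeight, ha, Bool.or_false, zero_add]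
      by_cases h1 : b 1 = v 0
      swap
      · simp [h1]
      simp only [h1, if_true, mul_one]
      -- A proper visit biases the state but makes the site pending, so the factor `Ψ` splits off
      -- whatever the state is. Without one, the weight is constant and invariance restores `π`
      -- after the step.
      cases hv0 : v 0 with
      | true =>
        simp only [ih2 (h1.trans hv0), ← mul_assoc]
        exact lintegral_mul_const _ ((hw 0).mul (hI t a))
      | false =>
        obtain ⟨c, hc⟩ := hv 0 hv0
        have hb1 : b 1 = false := h1.trans hv0
        have step : ∀ k, ∫⁻ x, w 0 x * ∫⁻ y, siteExp K π κ k (fun s => w (s + 1))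
            (fun s => v (s + 1)) (fun s => b (s + 1)) y ∂(coinStep K π κ (a, x)) ∂π =
            c * ∫⁻ x, siteExp K π κ k (fun s => w (s + 1)) (fun s => v (s + 1))
              (fun s => b (s + 1)) (false, x) ∂π := by
          intro k
          rw [hc, lintegral_const_mul _ (hI k a)]
          congr 1
          refine Eq.trans ?_
            (lintegral_invariant_coinStep hK hπ a ((hm' k).comp (hpair false)))
          refine lintegral_congr fun x => lintegral_congr fun y => ?_
          exact siteExp_of_not_pending k _ _ hb1 y
        rw [step, step, ih1 hb1, mul_assoc]
    -- At a pending site the next coin decides: success gives a fresh state, while failure forces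
    -- the site to stay pending and the induction hypothesis applies from the present state.
    refine ⟨fun hb0 => fresh false (by simp [hb0]), fun hb0 z => ?_⟩
    rw [lintegral_coinStep K π κ z (hm _), lintegral_coinStep K π κ z (hm _),
      fresh true (by simp), add_mul, mul_assoc, mul_assoc]
    congr 2
    rw [← lintegral_mul_const _ (show Measurable fun x => siteExp K π κ (t + 1) w v b (false, x)
      from (hm _).comp (hpair false))]
    refine lintegral_congr fun x => ?_
    simp only [siteExp_succ, siteWeight, hb0, zero_add, Bool.true_and, Bool.not_false,
      Bool.or_true]
    by_cases h1 : b 1 = true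
    · rw [ih2 h1]
      ring
    · simp [h1]

end OneSite

/-! ### Path probabilities of Markov chains -/

section Segments

variable {E : Type*} [MeasurableSpace E] [MeasurableSingletonClass E]

theorem chainExp_indicator_segment (κ : ℕ → Kernel E E) (n : ℕ) (u : ℕ → E) (x : E) :
    chainExp κ n (fun s => Set.indicator {u s} 1) (Set.indicator {u n} 1) x =
      Set.indicator {u 0} 1 x * ∏ s ∈ Finset.range n, κ s (u s) {u (s + 1)} := by
  induction n generalizing κ u x with
  | zero => simp [chainExp]
  | succ n ih =>
    rw [chainExp_succ']
    have h := ih (fun m => κ (m + 1)) (fun m => u (m + 1))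
    simp only [h]
    by_cases hx : x = u 0
    · subst hx
      rw [lintegral_mul_const _ (measurable_one.indicator (measurableSet_singleton _)),
        lintegral_indicator_one (measurableSet_singleton _), Finset.prod_range_succ']
      ring
    · simp [hx]

/-- The probability that a Markov chain follows a given path. -/
theorem chainLaw_segment (κ : ℕ → Kernel E E) [∀ n, IsMarkovKernel (κ n)] (n : ℕ) (u : ℕ → E)
    (x : E) : chainLaw (Measure.dirac x) κ (segment (n + 1) u) =
      Set.indicator {u 0} 1 x * ∏ s ∈ Finset.range n, κ s (u s) {u (s + 1)} := by
  have hm : ∀ s, Measurable (Set.indicator {u s} (1 : E → ℝ≥0∞)) := fun s =>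
    measurable_one.indicator (measurableSet_singleton _)
  have h := lintegral_chainLaw_prod (Measure.dirac x) κ n hm (hm n)
  rw [lintegral_dirac' _ (measurable_chainExp κ n hm (hm n)), chainExp_indicator_segment] at h
  rw [← h, ← lintegral_indicator_one (measurableSet_segment _ _)]
  refine lintegral_congr fun z => ?_
  rw [← Finset.prod_range_succ fun s => Set.indicator {u s} (1 : E → ℝ≥0∞) (z s)]
  by_cases hz : z ∈ segment (n + 1) u
  · rw [Set.indicator_of_mem hz]
    refine (Finset.prod_eq_one fun s hs => ?_).symm
    rw [Set.indicator_of_mem (by simpa using hz s (Finset.mem_range.1 hs))]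
    rfl
  · rw [Set.indicator_of_notMem hz]
    simp only [segment, Set.mem_ofPred_eq, not_forall] at hz
    obtain ⟨s, hs, hne⟩ := hz
    refine (Finset.prod_eq_zero (Finset.mem_range.2 hs) ?_).symm
    exact Set.indicator_of_notMem (by simpa using hne) _

end Segments

/-! ### Path probabilities of the walk -/

section Model

variable {d : ℕ} {S : Type*} [MeasurableSpace S]

theorem walkStep_sectR_singleton {Θ T : Type*} [MeasurableSpace Θ] [MeasurableSpace T]
    (k : Kernel T (LatticePt d)) [IsMarkovKernel k] (g : Θ × LatticePt d → T) (hg : Measurable g)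
    (θ : Θ) (x y : LatticePt d) : (walkStep k g hg).sectR θ x {y} = k (g (θ, x)) {y - x} := by
  rw [Kernel.sectR_apply, walkStep, Kernel.map_apply' _ (by fun_prop) _ (measurableSet_singleton _),
    Kernel.prod_apply' _ _ _ (measurable_add (measurableSet_singleton _)),
    Kernel.deterministic_apply, lintegral_dirac, Kernel.comap_apply]
  congr 1
  ext z
  simp [eq_sub_iff_add_eq']

theorem quenchedLaw_segment (p : Kernel S (LatticePt d)) [IsMarkovKernel p] (x : LatticePt d)
    (ω : Env d S) (n : ℕ) (u : ℕ → LatticePt d) :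
    quenchedLaw p x ω (segment (n + 1) u) =
      Set.indicator {u 0} 1 x * ∏ s ∈ Finset.range n, p (ω (u s) s) {u (s + 1) - u s} := by
  refine (chainLaw_segment _ n u x).trans ?_
  simp only [walkStep_sectR_singleton]

variable (p : Kernel S (LatticePt d)) [IsMarkovKernel p] (K : Kernel S S) [IsMarkovKernel K]
    (π : Measure S) [IsProbabilityMeasure π] (κ ε : I) (q : Measure (LatticePt d))
    [IsProbabilityMeasure q]

theorem coinWalkLaw_segment (x : LatticePt d) (θ : Env d (Bool × S) × (ℕ → Bool)) (n : ℕ)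
    (u : ℕ → LatticePt d) :
    coinWalkLaw p ε q x θ (segment (n + 1) u) = Set.indicator {u 0} 1 x *
      ∏ s ∈ Finset.range n, coinJump p ε q (θ.2 (s + 1), (θ.1 (u s) s).2) {u (s + 1) - u s} := by
  refine (chainLaw_segment _ n u x).trans ?_
  simp only [walkStep_sectR_singleton]

theorem annealedLaw_segment (x : LatticePt d) (n : ℕ) (u : ℕ → LatticePt d) :
    annealedLaw p K π x (Prod.snd ⁻¹' segment (n + 1) u) = Set.indicator {u 0} 1 x *
      ∫⁻ ω, ∏ s ∈ Finset.range n, p (ω (u s) s) {u (s + 1) - u s} ∂(envLaw d K π) := by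
  have hm : Measurable fun ω : Env d S => ∏ s ∈ Finset.range n, p (ω (u s) s) {u (s + 1) - u s} := by
    refine Finset.measurable_prod _ fun s _ => ?_
    exact (p.measurable_coe (measurableSet_singleton _)).comp
      (show Measurable fun ω : Env d S => ω (u s) s by fun_prop)
  rw [annealedLaw, Measure.compProd_apply (measurable_snd (measurableSet_segment _ _)),
    ← lintegral_const_mul _ hm]
  refine lintegral_congr fun ω => ?_
  exact quenchedLaw_segment p x ω n u

theorem measurable_coinJump_prod (n : ℕ) (u : ℕ → LatticePt d) :
    Measurable fun θ : Env d (Bool × S) × (ℕ → Bool) =>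
      ∏ s ∈ Finset.range n, coinJump p ε q (θ.2 (s + 1), (θ.1 (u s) s).2) {u (s + 1) - u s} := by
  refine Finset.measurable_prod _ fun s _ => ?_
  exact ((coinJump p ε q).measurable_coe (measurableSet_singleton _)).comp
    (show Measurable fun θ : Env d (Bool × S) × (ℕ → Bool) => (θ.2 (s + 1), (θ.1 (u s) s).2)
      by fun_prop)

/-- Since `G` reads only the environment and the coins, conditioning on these leaves the product of
jump probabilities along the path. -/
theorem setLIntegral_extendedLaw_segment (x : LatticePt d) (n : ℕ) (u : ℕ → LatticePt d)
    {G : Env d (Bool × S) × (ℕ → Bool) → ℝ≥0∞} (hG : Measurable G) :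
    ∫⁻ z in Prod.snd ⁻¹' segment (n + 1) u, G z.1 ∂(extendedLaw p K π κ ε q x) =
      Set.indicator {u 0} 1 x * ∫⁻ ζ, ∫⁻ e, G (ζ, e) * ∏ s ∈ Finset.range n,
        coinJump p ε q (e (s + 1), (ζ (u s) s).2) {u (s + 1) - u s}
          ∂(epsCoinLaw ε) ∂(coinEnvLaw d K π κ) := by
  have hs : MeasurableSet (segment (n + 1) u) := measurableSet_segment _ _
  have hm : Measurable fun θ : Env d (Bool × S) × (ℕ → Bool) => G θ * ∏ s ∈ Finset.range n,
      coinJump p ε q (θ.2 (s + 1), (θ.1 (u s) s).2) {u (s + 1) - u s} :=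
    hG.mul (measurable_coinJump_prod p ε q n u)
  have hG' : Measurable fun z : (Env d (Bool × S) × (ℕ → Bool)) × (ℕ → LatticePt d) => G z.1 :=
    hG.comp measurable_fst
  have hprod := lintegral_prod (μ := coinEnvLaw d K π κ) (ν := epsCoinLaw ε) _ hm.aemeasurable
  rw [← hprod, ← lintegral_const_mul _ hm,
    ← lintegral_indicator (measurable_snd hs), extendedLaw,
    Measure.lintegral_compProd (hG'.indicator (measurable_snd hs))]
  refine lintegral_congr fun θ => ?_
  have : ∀ X : ℕ → LatticePt d, (Prod.snd ⁻¹' segment (n + 1) u).indicator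
      (fun z : (Env d (Bool × S) × (ℕ → Bool)) × (ℕ → LatticePt d) => G z.1) (θ, X) =
      G θ * (segment (n + 1) u).indicator 1 X := fun X => by
    by_cases hX : X ∈ segment (n + 1) u <;> simp [hX]
  simp only [this]
  rw [lintegral_const_mul _ (measurable_one.indicator hs), lintegral_indicator_one hs,
    coinWalkLaw_segment]
  ring

theorem ae_extendedLaw_start (x : LatticePt d) :
    ∀ᵐ z ∂(extendedLaw p K π κ ε q x), z.2 0 = x := by
  have h := setLIntegral_extendedLaw_segment p K π κ ε q x 0 (fun _ => x) measurable_const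
    (G := fun _ => 1)
  simp only [zero_add, Finset.range_zero, Finset.prod_empty, mul_one, lintegral_const,
    measure_univ, Set.indicator_of_mem (Set.mem_singleton x), Pi.one_apply,
    Measure.restrict_apply_univ, one_mul] at h
  have h2 := (prob_compl_eq_zero_iff (measurable_snd (measurableSet_segment 1 fun _ => x))).2 h
  refine measure_mono_null (fun z hz => ?_) h2
  exact fun h3 => hz (h3 0 Nat.zero_lt_one)

/-- The coin with index `0` drives no step, so it is given the factor `1`. -/
theorem lintegral_epsCoinLaw_prod (n : ℕ) (G : ℕ → Bool → ℝ≥0∞) :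
    ∫⁻ e, ∏ s ∈ Finset.range n, G s (e (s + 1)) ∂(epsCoinLaw ε) =
      ∏ s ∈ Finset.range n, ∫⁻ a, G s a ∂(bernoulliMeasure true false ε) := by
  have h := lintegral_infinitePi_prod (fun _ : ℕ => bernoulliMeasure true false ε)
    (Finset.range (n + 1)) (F := fun i => if i = 0 then fun _ => 1 else G (i - 1))
    fun i => measurable_of_countable _
  simpa [Finset.prod_range_succ', epsCoinLaw] using h

end Model

/-! ### Forgetting the coins -/

section Marginals

variable {d : ℕ} {S : Type*} [MeasurableSpace S] {p : Kernel S (LatticePt d)} [IsMarkovKernel p]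
  {K : Kernel S S} [IsMarkovKernel K] {π : Measure S} [IsProbabilityMeasure π] {κ ε : I}
  {q : Measure (LatticePt d)} [IsProbabilityMeasure q]

/-- When no weight reads a coin, every coin can be averaged out, and the states alone form the chain
with kernel `K`. -/
theorem chainExp_coinStep_snd (hK : Minorized K π κ) (n : ℕ) {f : ℕ → S → ℝ≥0∞}
    (hf : ∀ n, Measurable (f n)) {h : S → ℝ≥0∞} (hh : Measurable h) (z : Bool × S) :
    chainExp (fun _ => coinStep K π κ) n (fun s y => f s y.2) (fun y => h y.2) z =
      chainExp (fun _ => K) n f h z.2 := by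
  induction n generalizing h with
  | zero => rfl
  | succ n ih =>
    simp only [chainExp, lintegral_coinStep_snd hK _ hh]
    exact ih ((hf n).mul hh.lintegral_kernel)

theorem lintegral_chainExp_invariant (hπ : K.Invariant π) (n : ℕ) {h : S → ℝ≥0∞}
    (hh : Measurable h) : ∫⁻ x, chainExp (fun _ => K) n (fun _ _ => 1) h x ∂π = ∫⁻ x, h x ∂π := by
  induction n generalizing h with
  | zero => rfl
  | succ n ih =>
    simp only [chainExp, one_mul]
    rw [ih hh.lintegral_kernel, ← Measure.lintegral_bind K.measurable.aemeasurable
      hh.aemeasurable, hπ.def]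

theorem lintegral_coinChain (n : ℕ) {f : ℕ → Bool × S → ℝ≥0∞} (hf : ∀ n, Measurable (f n))
    {h : Bool × S → ℝ≥0∞} (hh : Measurable h) :
    ∫⁻ z, (∏ s ∈ Finset.range n, f s (z s)) * h (z n)
        ∂(chainLaw ((Measure.dirac false).prod π) fun _ => coinStep K π κ) =
      ∫⁻ x, chainExp (fun _ => coinStep K π κ) n f h (false, x) ∂π := by
  rw [lintegral_chainLaw_prod _ _ n hf hh, Measure.dirac_prod,
    lintegral_map (measurable_chainExp _ n hf hh) (by fun_prop)]

theorem lintegral_coinEnvLaw_state (hK : Minorized K π κ) (hπ : K.Invariant π) (y : LatticePt d)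
    (n : ℕ) {h : S → ℝ≥0∞} (hh : Measurable h) :
    ∫⁻ ζ, h (ζ y n).2 ∂(coinEnvLaw d K π κ) = ∫⁻ x, h x ∂π := by
  have h1 := lintegral_infinitePi_prod
    (fun _ : LatticePt d => chainLaw ((Measure.dirac false).prod π) fun _ => coinStep K π κ) {y}
    (F := fun _ z => h (z n).2) fun _ => by fun_prop
  simp only [Finset.prod_singleton] at h1
  rw [coinEnvLaw, h1]
  have h2 := lintegral_coinChain (K := K) (π := π) (κ := κ) n (f := fun _ _ => 1)
    (fun _ => measurable_const) (h := fun y => h y.2) (by fun_prop)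
  simp only [Finset.prod_const_one, one_mul] at h2
  rw [h2]
  simp only [chainExp_coinStep_snd hK n (f := fun _ _ => 1) (fun _ => measurable_const) hh]
  exact lintegral_chainExp_invariant hπ n hh

theorem lintegral_envLaw_zero (y : LatticePt d) {h : S → ℝ≥0∞} (hh : Measurable h) :
    ∫⁻ ω, h (ω y 0) ∂(envLaw d K π) = ∫⁻ x, h x ∂π := by
  have h1 := lintegral_infinitePi_prod
    (fun _ : LatticePt d => chainLaw π fun _ => K) {y}
    (F := fun _ z => h (z 0)) fun _ => by fun_prop
  simp only [Finset.prod_singleton] at h1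
  rw [envLaw, h1, lintegral_chainLaw_zero π _ hh]

/-- Regroups the factors by the site visited, so that independence over sites can be used. -/
theorem prod_along_path {α β : Type*} [DecidableEq β] {M : Type*} [CommMonoid M] (n : ℕ)
    (u : ℕ → β) {V : Finset β} (hV : ∀ s < n, u s ∈ V) (g : ℕ → α → M) (ω : β → ℕ → α) :
    ∏ s ∈ Finset.range n, g s (ω (u s) s) =
      ∏ y ∈ V, ∏ s ∈ Finset.range n, if u s = y then g s (ω y s) else 1 := by
  rw [Finset.prod_comm]
  refine Finset.prod_congr rfl fun s hs => ?_
  rw [Finset.prod_ite_eq, if_pos (hV s (Finset.mem_range.1 hs))]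

/-- Along a path, the coins do not influence the law of the states of the environment. -/
theorem lintegral_coinEnvLaw_path (hK : Minorized K π κ) (n : ℕ) (u : ℕ → LatticePt d)
    {g : ℕ → S → ℝ≥0∞} (hg : ∀ s, Measurable (g s)) :
    ∫⁻ ζ, ∏ s ∈ Finset.range n, g s (ζ (u s) s).2 ∂(coinEnvLaw d K π κ) =
      ∫⁻ ω, ∏ s ∈ Finset.range n, g s (ω (u s) s) ∂(envLaw d K π) := by
  classical
  have hV : ∀ s < n, u s ∈ (Finset.range n).image u := fun s hs =>
    Finset.mem_image_of_mem _ (Finset.mem_range.2 hs)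
  have hm : ∀ (y : LatticePt d) (s : ℕ), Measurable fun x => if u s = y then g s x else 1 :=
    fun y s => by
      by_cases h : u s = y
      · simpa [h] using hg s
      · simp [h]
  simp only [prod_along_path n u hV (fun s (z : Bool × S) => g s z.2), prod_along_path n u hV g]
  have e1 := lintegral_infinitePi_prod
    (fun _ : LatticePt d => chainLaw ((Measure.dirac false).prod π) fun _ => coinStep K π κ)
    ((Finset.range n).image u)
    (F := fun y z => ∏ s ∈ Finset.range n, if u s = y then g s (z s).2 else 1)
    fun y => Finset.measurable_prod _ fun s _ =>
      (hm y s).comp (measurable_snd.comp (measurable_pi_apply s))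
  have e2 := lintegral_infinitePi_prod (fun _ : LatticePt d => chainLaw π fun _ => K)
    ((Finset.range n).image u)
    (F := fun y z => ∏ s ∈ Finset.range n, if u s = y then g s (z s) else 1)
    fun y => Finset.measurable_prod _ fun s _ => (hm y s).comp (measurable_pi_apply s)
  rw [coinEnvLaw, envLaw, e1, e2]
  refine Finset.prod_congr rfl fun y _ => ?_
  have h1 := lintegral_coinChain (K := K) (π := π) (κ := κ) n
    (f := fun s z => if u s = y then g s z.2 else 1) (h := fun _ => 1)
    (fun s => (hm y s).comp measurable_snd) measurable_const
  have h2 := lintegral_chainLaw_prod π (fun _ => K) n (f := fun s z => if u s = y then g s z else 1)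
    (h := fun _ => 1) (hm y) measurable_const
  simp only [mul_one] at h1 h2
  rw [h1, h2]
  exact lintegral_congr fun x => chainExp_coinStep_snd hK n (hm y) measurable_const (false, x)

theorem Assumption.minorized (hA : Assumption p K π κ ε q) : Minorized K π κ := by
  intro w
  refine Measure.le_iff.2 fun A hA' => ?_
  have h := hA.minorization w A hA'
  rw [Measure.smul_apply, ENNReal.smul_def, smul_eq_mul, ← ENNReal.toReal_le_toReal
    (ENNReal.mul_ne_top ENNReal.coe_ne_top (measure_ne_top _ _)) (measure_ne_top _ _)]
  simpa [measureReal_def] using h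

theorem smul_le_iff_singleton {E : Type*} [MeasurableSpace E] [Countable E]
    [MeasurableSingletonClass E] {m m' : Measure E} {c : ℝ≥0} :
    c • m ≤ m' ↔ ∀ y, c * m {y} ≤ m' {y} := by
  refine ⟨fun h y => h {y}, fun h => Measure.le_iff.2 fun A hA => ?_⟩
  rw [← Measure.tsum_indicator_apply_singleton m' A hA,
    ← Measure.tsum_indicator_apply_singleton (c • m) A hA]
  refine ENNReal.tsum_le_tsum fun y => Set.indicator_le_indicator ?_
  exact h y

/-- Without this measurability `residualKernel p q ε` would fall back on its default value;
countability of the lattice reduces it to singletons. -/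
theorem measurableSet_elliptic (c : ℝ≥0) (m : Measure (LatticePt d)) :
    MeasurableSet {w | c • m ≤ p w} := by
  have : {w | c • m ≤ p w} = ⋂ y, {w | c * m {y} ≤ p w {y}} := by
    ext w
    simp [smul_le_iff_singleton]
  rw [this]
  exact .iInter fun y =>
    measurableSet_le measurable_const (p.measurable_coe (measurableSet_singleton y))

theorem Assumption.ae_elliptic (hA : Assumption p K π κ ε q) :
    ∀ᵐ w ∂π, unitInterval.toNNReal ε • q ≤ p w := by
  have hm := measurableSet_elliptic (p := p) (unitInterval.toNNReal ε) q
  -- One site at time `0` suffices, because the state there has law exactly `π`.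
  have h0 : ∀ᵐ ω ∂(envLaw d K π), unitInterval.toNNReal ε • q ≤ p (ω 0 0) := by
    have := ae_all_iff.2 fun y => hA.elliptic 0 y 0
    filter_upwards [this] with ω hω
    refine smul_le_iff_singleton.2 fun y => ?_
    have h := hω y
    rw [sub_zero] at h
    rw [← ENNReal.toReal_le_toReal (ENNReal.mul_ne_top ENNReal.coe_ne_top (measure_ne_top _ _))
      (measure_ne_top _ _)]
    simpa [measureReal_def] using h
  have h1 := lintegral_envLaw_zero (d := d) (K := K) (π := π) 0
    (measurable_one.indicator hm.compl)
  rw [lintegral_indicator_one hm.compl, lintegral_eq_zero_of_ae_eq_zero] at h1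
  · exact h1.symm
  · filter_upwards [h0] with ω hω
    simpa using hω

theorem Assumption.ae_elliptic_coinEnvLaw (hA : Assumption p K π κ ε q) (hπ : K.Invariant π) :
    ∀ᵐ ζ ∂(coinEnvLaw d K π κ), ∀ (y : LatticePt d) (s : ℕ),
      unitInterval.toNNReal ε • q ≤ p (ζ y s).2 := by
  have hm := measurableSet_elliptic (p := p) (unitInterval.toNNReal ε) q
  refine ae_all_iff.2 fun y => ae_all_iff.2 fun s => ?_
  have h1 := lintegral_coinEnvLaw_state (d := d) hA.minorized hπ y s
    (measurable_one.indicator hm.compl)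
  rw [lintegral_indicator_one hm.compl, show π {w | unitInterval.toNNReal ε • q ≤ p w}ᶜ = 0 from
    hA.ae_elliptic] at h1
  have hf : Measurable fun ζ : Env d (Bool × S) =>
      {w | unitInterval.toNNReal ε • q ≤ p w}ᶜ.indicator (1 : S → ℝ≥0∞) (ζ y s).2 :=
    (measurable_one.indicator hm.compl).comp
      (show Measurable fun ζ : Env d (Bool × S) => (ζ y s).2 by fun_prop)
  filter_upwards [(lintegral_eq_zero_iff hf).1 h1] with ζ hζ
  simpa [Set.indicator_apply] using hζ

theorem lintegral_coinJump {w : S} (hw : unitInterval.toNNReal ε • q ≤ p w) (y : LatticePt d) :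
    ∫⁻ a, coinJump p ε q (a, w) {y} ∂(bernoulliMeasure true false ε) = p w {y} := by
  rw [lintegral_bernoulli, ← smul_add_smul_residualKernel p q ε (measurableSet_elliptic _ q) hw]
  rfl

/-- The walk has the same law with and without the coins. -/
theorem map_snd_extendedLaw (hA : Assumption p K π κ ε q) (hπ : K.Invariant π) (x : LatticePt d) :
    (extendedLaw p K π κ ε q x).map Prod.snd = (annealedLaw p K π x).map Prod.snd := by
  have : IsProbabilityMeasure ((extendedLaw p K π κ ε q x).map Prod.snd) :=
    Measure.isProbabilityMeasure_map measurable_snd.aemeasurable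
  have : IsProbabilityMeasure ((annealedLaw p K π x).map Prod.snd) :=
    Measure.isProbabilityMeasure_map measurable_snd.aemeasurable
  refine ext_of_initialSegments fun n u => ?_
  change _ = ((annealedLaw p K π x).map Prod.snd) (segment n u)
  change ((extendedLaw p K π κ ε q x).map Prod.snd) (segment n u) = _
  cases n with
  | zero =>
    have : segment 0 u = Set.univ := by ext; simp [segment]
    rw [this, measure_univ, measure_univ]
  | succ n =>
    have hs : MeasurableSet (segment (n + 1) u) := measurableSet_segment _ _
    rw [Measure.map_apply measurable_snd hs, Measure.map_apply measurable_snd hs,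
      annealedLaw_segment]
    have h := setLIntegral_extendedLaw_segment p K π κ ε q x n u (G := fun _ => 1) measurable_const
    rw [setLIntegral_one] at h
    rw [h]
    congr 1
    simp only [one_mul]
    rw [← lintegral_coinEnvLaw_path (hA.minorized) n u (g := fun s w => p w {u (s + 1) - u s})
      fun s => p.measurable_coe (measurableSet_singleton _)]
    -- On elliptic environments, averaging over the `ε`-coins turns each `coinJump` probability into
    -- the original jump probability.
    refine lintegral_congr_ae ?_
    filter_upwards [hA.ae_elliptic_coinEnvLaw hπ] with ζ hζ
    rw [lintegral_epsCoinLaw_prod ε n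
      fun s a => coinJump p ε q (a, (ζ (u s) s).2) {u (s + 1) - u s}]
    exact Finset.prod_congr rfl fun s _ => lintegral_coinJump (hζ _ _) _

theorem coinJump_eq_zero (hp : ∀ s, p s (nbhd d)ᶜ = 0) (hA : Assumption p K π κ ε q)
    (z : Bool × S) {y : LatticePt d} (hy : y ∉ nbhd d) : coinJump p ε q z {y} = 0 := by
  change (if z.1 = true then q else residualKernel p q ε z.2) {y} = 0
  have hsub : {y} ⊆ (nbhd d)ᶜ := by simpa using hy
  split_ifs
  · exact measure_mono_null hsub hA.nearest_neighbour
  · exact residualKernel_apply_eq_zero p q ε (measure_mono_null hsub (hp _))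

/-- The walk makes steps to nearest neighbours. -/
theorem ae_steps_mem_nbhd (hp : ∀ s, p s (nbhd d)ᶜ = 0) (hA : Assumption p K π κ ε q)
    (x : LatticePt d) :
    ∀ᵐ z ∂(extendedLaw p K π κ ε q x), ∀ n, z.2 (n + 1) - z.2 n ∈ nbhd d := by
  refine ae_all_iff.2 fun n => ?_
  -- The bad event is a countable union of path segments, each with a forbidden last jump and hence
  -- of probability zero.
  have hdet : DeterminedBy (n + 1 + 1) {X : ℕ → LatticePt d | X (n + 1) - X n ∉ nbhd d} := by
    intro X X' h hX
    simpa [← h (n + 1) (by omega), ← h n (by omega)] using hX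
  obtain ⟨B, v, hv, hU, -⟩ := hdet.exists_segments
  change extendedLaw p K π κ ε q x (Prod.snd ⁻¹' {X : ℕ → LatticePt d | X (n + 1) - X n ∉ nbhd d}) = 0
  rw [hU, Set.preimage_iUnion, measure_iUnion_null_iff]
  intro i
  have h := setLIntegral_extendedLaw_segment p K π κ ε q x (n + 1) (v i) (G := fun _ => 1)
    measurable_const
  rw [setLIntegral_one] at h
  rw [h, lintegral_eq_zero_of_ae_eq_zero, mul_zero]
  refine ae_of_all _ fun ζ => ?_
  refine lintegral_eq_zero_of_ae_eq_zero (ae_of_all _ fun e => ?_)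
  dsimp only
  rw [Finset.prod_range_succ, coinJump_eq_zero hp hA _ (hv i)]
  simp

end Marginals

/-! ### Pending sites and the regeneration time -/

section Pending

variable {d : ℕ} {S : Type*}

/-- The sites whose environment has not been renewed, strictly before time `t`, since the last
proper visit. -/
def pendingSites (z : (Env d (Bool × S) × (ℕ → Bool)) × (ℕ → LatticePt d)) :
    ℕ → Finset (LatticePt d)
  | 0 => ∅
  | t + 1 => {y ∈ pendingSites z t | (z.1.1 y t).1 = false} ∪ if z.1.2 (t + 1) then ∅ else {z.2 t}

variable (z : (Env d (Bool × S) × (ℕ → Bool)) × (ℕ → LatticePt d))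

theorem mem_pendingSites_succ {t : ℕ} {y : LatticePt d} :
    y ∈ pendingSites z (t + 1) ↔ (z.2 t = y ∧ z.1.2 (t + 1) = false) ∨
      (y ∈ pendingSites z t ∧ (z.1.1 y t).1 = false) := by
  rw [pendingSites, Finset.mem_union, Finset.mem_filter, or_comm]
  cases h : z.1.2 (t + 1) <;> simp [eq_comm (a := y) (b := z.2 t)]

theorem properVisits_succ (X : ℕ → LatticePt d) (e : ℕ → Bool) (t : ℕ) (y : LatticePt d) :
    properVisits X e (t + 1) y =
      if X t = y ∧ e (t + 1) = false then insert (t + 1) (properVisits X e t y)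
      else properVisits X e t y := by
  rw [properVisits, properVisits, ← Order.succ_eq_add_one,
    ← Finset.insert_Icc_right_eq_Icc_succ (by simp), Finset.filter_insert]
  simp

theorem lastVisit_le (X : ℕ → LatticePt d) (e : ℕ → Bool) (t : ℕ) (y : LatticePt d) :
    lastVisit X e t y ≤ t :=
  Finset.sup_le fun _ hs => (Finset.mem_Icc.1 (Finset.mem_filter.1 hs).1).2

/-- Unrolls the recursion. A proper visit during the step to `t + 1` has index `t + 1`, so it
empties the window of coins to be inspected. -/
theorem mem_pendingSites {t : ℕ} {y : LatticePt d} :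
    y ∈ pendingSites z t ↔ (properVisits z.2 z.1.2 t y).Nonempty ∧
      ∀ s, lastVisit z.2 z.1.2 t y ≤ s → s < t → (z.1.1 y s).1 = false := by
  induction t with
  | zero => simp [pendingSites, properVisits]
  | succ t ih =>
    rw [mem_pendingSites_succ, lastVisit, properVisits_succ]
    by_cases h : z.2 t = y ∧ z.1.2 (t + 1) = false
    · rw [if_pos h, Finset.sup_insert]
      simp only [h, and_self, true_or, Finset.insert_nonempty, true_and, true_iff, id]
      intro s h1 h2
      have := (le_sup_left : t + 1 ≤ _).trans h1
      omega
    · rw [if_neg h, ← lastVisit, ih]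
      simp only [h, false_or, and_assoc]
      refine and_congr_right fun _ => ⟨fun h1 s h2 h3 => ?_, fun h1 => ⟨fun s h2 h3 =>
        h1 s h2 (by omega), h1 t (lastVisit_le _ _ _ _) (by omega)⟩⟩
      rcases Nat.lt_succ_iff_lt_or_eq.1 h3 with h4 | rfl
      · exact h1.1 s h2 h4
      · exact h1.2

/-- The infimum is below `t` exactly when some success occurs in the window from the last visit to
`t`. A site without visits has value `0`, which is why `0 < t` is required. -/
theorem lastVisit_add_freshDelay_lt_iff {t : ℕ} (ht : 0 < t) (y : LatticePt d) :
    (lastVisit z.2 z.1.2 t y : ℕ∞) + freshDelay (fun x s => (z.1.1 x s).1) z.2 z.1.2 t y < t ↔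
      y ∉ pendingSites z t := by
  rw [mem_pendingSites, freshDelay, visitCount]
  by_cases h : (properVisits z.2 z.1.2 t y).Nonempty
  · rw [if_neg (Finset.card_ne_zero.2 h)]
    simp only [h, true_and, not_forall, Bool.not_eq_false, exists_prop]
    rw [show (lastVisit z.2 z.1.2 t y : ℕ∞) + ⨅ s ∈ {s : ℕ | (z.1.1 y (lastVisit z.2 z.1.2 t y +
      s)).1 = true}, (s : ℕ∞) = ⨅ s ∈ {s : ℕ | (z.1.1 y (lastVisit z.2 z.1.2 t y + s)).1 = true},
      ((lastVisit z.2 z.1.2 t y : ℕ∞) + s) by simp only [ENat.add_iInf]]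
    simp only [iInf_lt_iff, Set.mem_ofPred_eq, exists_prop]
    constructor
    · rintro ⟨s, h1, h2⟩
      exact ⟨_, Nat.le_add_right _ s, by exact_mod_cast h2, h1⟩
    · rintro ⟨s, h1, h2, h3⟩
      refine ⟨s - lastVisit z.2 z.1.2 t y, by rwa [Nat.add_sub_cancel' h1], ?_⟩
      have : lastVisit z.2 z.1.2 t y + (s - lastVisit z.2 z.1.2 t y) < t := by omega
      exact_mod_cast this
  · rw [Finset.not_nonempty_iff_eq_empty] at h
    simpa [h, lastVisit] using ht

theorem regenTime_eq : regenTime z =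
    ⨅ t ∈ {t : ℕ | 0 < t ∧ pendingSites z t = ∅}, (t : ℕ∞) := by
  have : {t : ℕ | 0 < t ∧ ∀ x : LatticePt d, (lastVisit z.2 z.1.2 t x : ℕ∞) +
      freshDelay (fun x s => (z.1.1 x s).1) z.2 z.1.2 t x < t} =
      {t : ℕ | 0 < t ∧ pendingSites z t = ∅} := by
    ext t
    refine and_congr_right fun ht => ?_
    simp only [lastVisit_add_freshDelay_lt_iff z ht, Finset.eq_empty_iff_forall_notMem]
  rw [regenTime, this]

end Pending

/-! ### The sequence of observations -/

/-- A step of the walk, the coin it used, and the sites pending afterwards, seen from the walk. -/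
abbrev Observation (d : ℕ) : Type := LatticePt d × Bool × Finset (LatticePt d)

instance (d : ℕ) : MeasurableSpace (Finset (LatticePt d)) := ⊤

instance (d : ℕ) : DiscreteMeasurableSpace (Finset (LatticePt d)) := ⟨fun _ => trivial⟩

/-- The number of pending sites of an observation. -/
def pendingCount {d : ℕ} (o : Observation d) : ℕ := o.2.2.card

section Observations

variable {d : ℕ} {S : Type*}

/-- The sequence of observations along the walk. -/
def observe (z : (Env d (Bool × S) × (ℕ → Bool)) × (ℕ → LatticePt d)) (t : ℕ) : Observation d :=
  (z.2 (t + 1) - z.2 t, z.1.2 (t + 1), (pendingSites z (t + 1)).image (· - z.2 (t + 1)))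

theorem pendingCount_observe (z : (Env d (Bool × S) × (ℕ → Bool)) × (ℕ → LatticePt d)) (t : ℕ) :
    pendingCount (observe z t) = (pendingSites z (t + 1)).card :=
  Finset.card_image_of_injective _ (sub_left_injective)

theorem exists_blockLength_observe {z : (Env d (Bool × S) × (ℕ → Bool)) × (ℕ → LatticePt d)}
    (h : ∃ n, observe z n ∈ {o | pendingCount o = 0}) :
    regenTime z = blockLength {o : Observation d | pendingCount o = 0} (observe z) := by
  obtain ⟨n, hn⟩ := exists_mem_firstVisit h
  rw [blockLength_of_mem_firstVisit hn, regenTime_eq]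
  have hiff : ∀ m, observe z m ∈ {o : Observation d | pendingCount o = 0} ↔
      pendingSites z (m + 1) = ∅ := fun m => by
    rw [Set.mem_ofPred_eq, pendingCount_observe, Finset.card_eq_zero]
  refine le_antisymm (iInf₂_le (n + 1) ⟨Nat.succ_pos n, (hiff n).1 hn.1⟩)
    (le_iInf₂ fun t ht => ?_)
  obtain ⟨m, rfl⟩ := Nat.exists_eq_add_one.2 ht.1
  have : n ≤ m := not_lt.1 fun hlt => hn.2 m hlt ((hiff m).2 ht.2)
  exact_mod_cast Nat.succ_le_succ this

variable [MeasurableSpace S]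

theorem measurable_of_mem_finset {Ω E : Type*} [MeasurableSpace Ω] [Countable E]
    [MeasurableSpace (Finset E)] {f : Ω → Finset E} (h : ∀ y, MeasurableSet {ω | y ∈ f ω}) :
    Measurable f := by
  refine measurable_to_countable' fun B => ?_
  have : f ⁻¹' {B} = ⋂ y, {ω | y ∈ f ω ↔ y ∈ B} := by
    ext ω
    simp [Finset.ext_iff]
  rw [this]
  exact .iInter fun y => (h y).iff (.const _)

theorem measurableSet_mem_pendingSites (t : ℕ) (y : LatticePt d) :
    MeasurableSet {z : (Env d (Bool × S) × (ℕ → Bool)) × (ℕ → LatticePt d) |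
      y ∈ pendingSites z t} := by
  induction t with
  | zero => simp [pendingSites]
  | succ t ih =>
    simp only [mem_pendingSites_succ]
    have h1 : Measurable fun z : (Env d (Bool × S) × (ℕ → Bool)) × (ℕ → LatticePt d) => z.2 t := by
      fun_prop
    have h2 : Measurable fun z : (Env d (Bool × S) × (ℕ → Bool)) × (ℕ → LatticePt d) =>
      z.1.2 (t + 1) := by fun_prop
    have h3 : Measurable fun z : (Env d (Bool × S) × (ℕ → Bool)) × (ℕ → LatticePt d) =>
      (z.1.1 y t).1 := by fun_prop
    exact ((h1 (measurableSet_singleton y)).inter (h2 (measurableSet_singleton false))).union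
      (ih.inter (h3 (measurableSet_singleton false)))

theorem measurable_observe : Measurable
    (observe : (Env d (Bool × S) × (ℕ → Bool)) × (ℕ → LatticePt d) → ℕ → Observation d) := by
  refine measurable_pi_lambda _ fun t => ?_
  have h1 : Measurable fun z : (Env d (Bool × S) × (ℕ → Bool)) × (ℕ → LatticePt d) =>
      z.2 (t + 1) := by fun_prop
  have h2 : Measurable fun z : (Env d (Bool × S) × (ℕ → Bool)) × (ℕ → LatticePt d) =>
      pendingSites z (t + 1) := measurable_of_mem_finset (measurableSet_mem_pendingSites (t + 1))
  have h3 : Measurable fun w : Finset (LatticePt d) × LatticePt d => w.1.image (· - w.2) :=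
    measurable_of_countable _
  exact (by fun_prop : Measurable fun z : (Env d (Bool × S) × (ℕ → Bool)) × (ℕ → LatticePt d) =>
      z.2 (t + 1) - z.2 t).prodMk ((by fun_prop : Measurable fun z : (Env d (Bool × S) ×
      (ℕ → Bool)) × (ℕ → LatticePt d) => z.1.2 (t + 1)).prodMk (h3.comp (h2.prodMk h1)))

/-- The position of the walk at time `t`, reconstructed from the observations. -/
def pathOf (u : ℕ → Observation d) (t : ℕ) : LatticePt d := ∑ s ∈ Finset.range t, (u s).1

/-- The pending sites at time `t`, reconstructed from the observations. -/
def pendingOf (u : ℕ → Observation d) : ℕ → Finset (LatticePt d)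
  | 0 => ∅
  | t + 1 => (u t).2.2.image (· + pathOf u (t + 1))

theorem pathOf_succ (u : ℕ → Observation d) (t : ℕ) : pathOf u (t + 1) = pathOf u t + (u t).1 :=
  Finset.sum_range_succ _ _

theorem pathOf_shiftSeq (u : ℕ → Observation d) (t s : ℕ) :
    pathOf (shiftSeq t u) s = pathOf u (t + s) - pathOf u t := by
  rw [pathOf, pathOf, pathOf, Finset.sum_range_add, add_sub_cancel_left]
  rfl

theorem card_pendingOf_succ (u : ℕ → Observation d) (t : ℕ) :
    (pendingOf u (t + 1)).card = pendingCount (u t) :=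
  Finset.card_image_of_injective _ (add_left_injective _)

/-- Pending sets are recorded relative to the walk, so shifting time only translates space. At `s =
0` the reconstruction is empty by definition, hence the hypothesis that it is empty at time `t`. -/
theorem mem_pendingOf_shiftSeq {u : ℕ → Observation d} {t : ℕ} (hu : pendingOf u t = ∅) (s : ℕ)
    (y : LatticePt d) :
    y ∈ pendingOf (shiftSeq t u) s ↔ y + pathOf u t ∈ pendingOf u (t + s) := by
  cases s with
  | zero => rw [add_zero, hu]; exact iff_of_false (Finset.notMem_empty _) (Finset.notMem_empty _)
  | succ s =>
    rw [pendingOf, ← add_assoc, pendingOf, pathOf_shiftSeq]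
    simp only [Finset.mem_image, shiftSeq]
    refine exists_congr fun a => and_congr_right fun _ => ?_
    rw [← add_assoc, ← add_sub_assoc, sub_eq_iff_eq_add]

/-- Observations are relative to the walk; knowing its starting point recovers the absolute path and
pending sets from them. -/
theorem observe_mem_segment_iff {z : (Env d (Bool × S) × (ℕ → Bool)) × (ℕ → LatticePt d)}
    (hz : z.2 0 = 0) (n : ℕ) (u : ℕ → Observation d) :
    observe z ∈ segment n u ↔ z.2 ∈ segment (n + 1) (pathOf u) ∧
      (∀ s < n, z.1.2 (s + 1) = (u s).2.1) ∧ ∀ s ≤ n, pendingSites z s = pendingOf u s := by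
  have himg : ∀ (A B : Finset (LatticePt d)) (x : LatticePt d),
      A.image (· - x) = B ↔ A = B.image (· + x) := by
    intro A B x
    constructor
    · rintro rfl
      rw [Finset.image_image]
      simp [Function.comp_def]
    · rintro rfl
      rw [Finset.image_image]
      simp [Function.comp_def]
  constructor
  · intro h
    have hX : ∀ s ≤ n, z.2 s = pathOf u s := by
      intro s hs
      induction s with
      | zero => simp [hz, pathOf]
      | succ s ih =>
        have h1 : z.2 (s + 1) - z.2 s = (u s).1 := congrArg Prod.fst (h s (by omega))
        rw [pathOf_succ, ← ih (by omega), ← h1]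
        abel
    refine ⟨fun s hs => hX s (by omega), fun s hs => congrArg (fun o => o.2.1) (h s hs), ?_⟩
    intro s hs
    cases s with
    | zero => rfl
    | succ s =>
      have h2 : (pendingSites z (s + 1)).image (· - z.2 (s + 1)) = (u s).2.2 :=
        congrArg (fun o => o.2.2) (h s (by omega))
      rw [pendingOf, ← hX (s + 1) hs]
      exact (himg _ _ _).1 h2
  · rintro ⟨h1, h2, h3⟩ s hs
    refine Prod.ext ?_ (Prod.ext (h2 s hs) ?_)
    · change z.2 (s + 1) - z.2 s = _
      rw [h1 (s + 1) (by omega), h1 s (by omega), pathOf_succ]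
      abel
    · refine (himg _ _ _).2 ?_
      rw [h3 (s + 1) (by omega), pendingOf, h1 (s + 1) (by omega)]

/-- Whether the step at time `s` is a proper visit to `y`. -/
def visitOf (u : ℕ → Observation d) (y : LatticePt d) (s : ℕ) : Bool :=
  decide (pathOf u s = y) && !(u s).2.1

/-- Whether `y` is pending at time `s`. -/
def isPendingOf (u : ℕ → Observation d) (y : LatticePt d) (s : ℕ) : Bool :=
  decide (y ∈ pendingOf u s)

/-- Given the path and the `ε`-coins, the pending sets are determined by a rule acting at each site
separately. Outside `V` there are neither visits nor pending sites, so nothing has to be checked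
there. -/
theorem pendingSites_eq_iff {z : (Env d (Bool × S) × (ℕ → Bool)) × (ℕ → LatticePt d)} {n : ℕ}
    {u : ℕ → Observation d} (hX : z.2 ∈ segment (n + 1) (pathOf u))
    (he : ∀ s < n, z.1.2 (s + 1) = (u s).2.1) {V : Finset (LatticePt d)}
    (hV : ∀ s < n, pathOf u s ∈ V) (hV' : ∀ s ≤ n, pendingOf u s ⊆ V) :
    (∀ s ≤ n, pendingSites z s = pendingOf u s) ↔ ∀ y ∈ V, ∀ s < n, isPendingOf u y (s + 1) =
      (visitOf u y s || (isPendingOf u y s && !(z.1.1 y s).1)) := by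
  have hrule : ∀ y, ∀ s < n, pendingSites z s = pendingOf u s →
      (isPendingOf u y (s + 1) = (visitOf u y s || (isPendingOf u y s && !(z.1.1 y s).1)) ↔
        (y ∈ pendingOf u (s + 1) ↔ y ∈ pendingSites z (s + 1))) := by
    intro y s hs h
    rw [mem_pendingSites_succ, he s hs, hX s (by omega), h, Bool.eq_iff_iff]
    simp [isPendingOf, visitOf]
  constructor
  · intro h y _ s hs
    rw [hrule y s hs (h s hs.le), h (s + 1) hs]
  · intro h s hs
    induction s with
    | zero => rfl
    | succ s ih =>
      have ih := ih (by omega)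
      ext y
      by_cases hy : y ∈ V
      · exact ((hrule y s hs ih).1 (h y hy s hs)).symm
      · have h1 : y ∉ pendingOf u (s + 1) := fun h => hy (hV' _ hs h)
        have h2 : y ∉ pendingOf u s := fun h => hy (hV' _ (by omega) h)
        have h3 : pathOf u s ≠ y := fun h => hy (h ▸ hV s hs)
        rw [mem_pendingSites_succ, hX s (by omega), ih]
        simp [h1, h2, h3]

end Observations

/-! ### Factorization of the law of the observations over the sites -/

section Cylinders

variable {d : ℕ} {S : Type*} [MeasurableSpace S] (p : Kernel S (LatticePt d)) [IsMarkovKernel p]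
  (K : Kernel S S) [IsMarkovKernel K] (π : Measure S) [IsProbabilityMeasure π] (κ ε : I)
  (q : Measure (LatticePt d)) [IsProbabilityMeasure q]

/-- The weight of the state at `y` in the probability of the step at time `s`. -/
def jumpWeightOf (u : ℕ → Observation d) (y : LatticePt d) (s : ℕ) (x : S) : ℝ≥0∞ :=
  if pathOf u s = y then coinJump p ε q ((u s).2.1, x) {(u s).1} else 1

theorem measurable_jumpWeightOf (u : ℕ → Observation d) (y : LatticePt d) (s : ℕ) :
    Measurable (jumpWeightOf p ε q u y s) := by
  unfold jumpWeightOf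
  by_cases h : pathOf u s = y
  · simp only [h, if_true]
    exact ((coinJump p ε q).measurable_coe (measurableSet_singleton _)).comp
      (show Measurable fun x : S => ((u s).2.1, x) by fun_prop)
  · simp only [h, if_false]
    exact measurable_const

/-- A step without a proper visit does not look at the state: either it starts elsewhere, or it is
drawn from `q`. -/
theorem jumpWeightOf_const (u : ℕ → Observation d) (y : LatticePt d) (s : ℕ)
    (h : visitOf u y s = false) : ∃ c, jumpWeightOf p ε q u y s = fun _ => c := by
  by_cases hy : pathOf u s = y
  · have he : (u s).2.1 = true := by simpa [visitOf, hy] using h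
    refine ⟨q {(u s).1}, funext fun x => ?_⟩
    rw [jumpWeightOf, if_pos hy, he]
    rfl
  · exact ⟨1, funext fun x => if_neg hy⟩

/-- The expected weight of the site `y` along the first `n` observations, with the expectation of a
final function `h`. -/
def siteFactor (n : ℕ) (u : ℕ → Observation d) (y : LatticePt d) (h : Bool × S → ℝ≥0∞) : ℝ≥0∞ :=
  ∫⁻ x, chainExp (fun _ => coinStep K π κ) n
    (siteWeight (jumpWeightOf p ε q u y) (visitOf u y) (isPendingOf u y)) h (false, x) ∂π

/-- The probability of a sequence of observations factorizes over the sites. -/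
theorem setLIntegral_observe (n : ℕ) (u : ℕ → Observation d) {V : Finset (LatticePt d)}
    (hV : ∀ s < n, pathOf u s ∈ V) (hV' : ∀ s ≤ n, pendingOf u s ⊆ V) (g : Bool → ℝ≥0∞)
    {h : LatticePt d → Bool × S → ℝ≥0∞} (hh : ∀ y, Measurable (h y)) :
    ∫⁻ z in observe ⁻¹' segment n u, g (z.1.2 (n + 1)) * ∏ y ∈ V, h y (z.1.1 y n)
        ∂(extendedLaw p K π κ ε q 0) =
      (∏ s ∈ Finset.range n, bernoulliMeasure true false ε {(u s).2.1}) *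
        (∫⁻ a, g a ∂(bernoulliMeasure true false ε)) *
        ∏ y ∈ V, siteFactor p K π κ ε q n u y (h y) := by
  let coins : (ℕ → Bool) → ℝ≥0∞ := fun e =>
    (∏ s ∈ Finset.range n, Set.indicator {(u s).2.1} 1 (e (s + 1))) * g (e (n + 1))
  let rule : LatticePt d → ℕ → Bool × S → ℝ≥0∞ := fun y s x =>
    if isPendingOf u y (s + 1) = (visitOf u y s || (isPendingOf u y s && !x.1)) then 1 else 0
  let sites : Env d (Bool × S) → ℝ≥0∞ := fun ζ =>
    ∏ y ∈ V, (∏ s ∈ Finset.range n, rule y s (ζ y s)) * h y (ζ y n)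
  let w : LatticePt d → ℕ → Bool × S → ℝ≥0∞ := fun y =>
    siteWeight (jumpWeightOf p ε q u y) (visitOf u y) (isPendingOf u y)
  have hw : ∀ y s, Measurable (w y s) := fun y =>
    measurable_siteWeight (measurable_jumpWeightOf p ε q u y) _ _
  have hrule : ∀ y s, Measurable (rule y s) := fun y s =>
    (measurable_of_countable fun a : Bool => if isPendingOf u y (s + 1) =
      (visitOf u y s || (isPendingOf u y s && !a)) then (1 : ℝ≥0∞) else 0).comp measurable_fst
  have hcoins : Measurable coins := by
    refine (Finset.measurable_prod _ fun s _ => ?_).mul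
      ((measurable_of_countable g).comp (measurable_pi_apply (n + 1)))
    exact (measurable_of_countable (Set.indicator {(u s).2.1} (1 : Bool → ℝ≥0∞))).comp
      (measurable_pi_apply (s + 1))
  have hev : ∀ (y : LatticePt d) (s : ℕ), Measurable fun ζ : Env d (Bool × S) => ζ y s :=
    fun y s => by fun_prop
  have hsites : Measurable sites := by
    refine Finset.measurable_prod _ fun y _ => Measurable.mul ?_ ((hh y).comp (hev y n))
    exact Finset.measurable_prod _ fun s _ => (hrule y s).comp (hev y s)
  -- The event becomes the event of following the path, with the prescribed coins and pending rules
  -- turned into indicator weights.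
  have step1 : ∫⁻ z in observe ⁻¹' segment n u, g (z.1.2 (n + 1)) * ∏ y ∈ V, h y (z.1.1 y n)
      ∂(extendedLaw p K π κ ε q 0) =
      ∫⁻ z in Prod.snd ⁻¹' segment (n + 1) (pathOf u), coins z.1.2 * sites z.1.1
        ∂(extendedLaw p K π κ ε q 0) := by
    rw [← lintegral_indicator (measurable_observe (measurableSet_segment n u)),
      ← lintegral_indicator (measurable_snd (measurableSet_segment _ _))]
    refine lintegral_congr_ae ?_
    filter_upwards [ae_extendedLaw_start p K π κ ε q 0] with z hz
    have hiff := observe_mem_segment_iff hz n u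
    by_cases hX : z.2 ∈ segment (n + 1) (pathOf u)
    swap
    · rw [Set.indicator_of_notMem (s := observe ⁻¹' segment n u) fun h => hX (hiff.1 h).1,
        Set.indicator_of_notMem (s := Prod.snd ⁻¹' segment (n + 1) (pathOf u)) hX]
    rw [Set.indicator_of_mem (s := Prod.snd ⁻¹' segment (n + 1) (pathOf u)) hX]
    by_cases he : ∀ s < n, z.1.2 (s + 1) = (u s).2.1
    swap
    · rw [Set.indicator_of_notMem (s := observe ⁻¹' segment n u) fun h => he (hiff.1 h).2.1]
      push Not at he
      obtain ⟨s, hs, hne⟩ := he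
      simp only [coins]
      rw [Finset.prod_eq_zero (Finset.mem_range.2 hs)]
      · simp
      · exact Set.indicator_of_notMem (by simpa using hne) _
    have hpe := pendingSites_eq_iff hX he hV hV'
    have hc : coins z.1.2 = g (z.1.2 (n + 1)) := by
      simp only [coins]
      rw [Finset.prod_eq_one fun s hs => ?_, one_mul]
      rw [he s (Finset.mem_range.1 hs)]
      simp
    rw [hc]
    by_cases hP : ∀ s ≤ n, pendingSites z s = pendingOf u s
    · rw [Set.indicator_of_mem (s := observe ⁻¹' segment n u) (hiff.2 ⟨hX, he, hP⟩)]
      congr 1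
      refine Finset.prod_congr rfl fun y hy => ?_
      rw [Finset.prod_eq_one fun s hs => ?_, one_mul]
      exact if_pos (hpe.1 hP y hy s (Finset.mem_range.1 hs))
    · rw [Set.indicator_of_notMem (s := observe ⁻¹' segment n u) fun h => hP (hiff.1 h).2.2]
      have hP' := mt hpe.2 hP
      push Not at hP'
      obtain ⟨y, hy, s, hs, hne⟩ := hP'
      have : sites z.1.1 = 0 := by
        refine Finset.prod_eq_zero hy ?_
        rw [Finset.prod_eq_zero (Finset.mem_range.2 hs), zero_mul]
        exact if_neg hne
      rw [this, mul_zero]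
  -- Each jump probability is charged to the site where the jump starts. The prescribed coins may be
  -- substituted because `coins e` vanishes otherwise.
  have step2 : ∀ (ζ : Env d (Bool × S)) (e : ℕ → Bool), coins e * sites ζ * ∏ s ∈ Finset.range n,
      coinJump p ε q (e (s + 1), (ζ (pathOf u s) s).2) {pathOf u (s + 1) - pathOf u s} =
      coins e * ∏ y ∈ V, (∏ s ∈ Finset.range n, w y s (ζ y s)) * h y (ζ y n) := by
    intro ζ e
    by_cases he : ∀ s < n, e (s + 1) = (u s).2.1
    · rw [mul_assoc]
      congr 1
      have h1 : ∏ s ∈ Finset.range n, coinJump p ε q (e (s + 1), (ζ (pathOf u s) s).2)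
          {pathOf u (s + 1) - pathOf u s} =
          ∏ y ∈ V, ∏ s ∈ Finset.range n, jumpWeightOf p ε q u y s (ζ y s).2 := by
        refine Eq.trans ?_ (prod_along_path n (pathOf u) hV
          (fun s (x : Bool × S) => coinJump p ε q ((u s).2.1, x.2) {(u s).1}) ζ)
        refine Finset.prod_congr rfl fun s hs => ?_
        rw [he s (Finset.mem_range.1 hs), pathOf_succ, add_sub_cancel_left]
      rw [h1, ← Finset.prod_mul_distrib]
      refine Finset.prod_congr rfl fun y _ => ?_
      rw [mul_right_comm, ← Finset.prod_mul_distrib]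
      congr 1
      exact Finset.prod_congr rfl fun s _ => mul_comm _ _
    · push Not at he
      obtain ⟨s, hs, hne⟩ := he
      have : coins e = 0 := by
        simp only [coins]
        rw [Finset.prod_eq_zero (Finset.mem_range.2 hs), zero_mul]
        exact Set.indicator_of_notMem (by simpa using hne) _
      simp [this]
  -- The coins `1, …, n` are prescribed, and the coin `n + 1` is left to `g`.
  have step3 : ∫⁻ e, coins e ∂(epsCoinLaw ε) =
      (∏ s ∈ Finset.range n, bernoulliMeasure true false ε {(u s).2.1}) *
        ∫⁻ a, g a ∂(bernoulliMeasure true false ε) := by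
    have := lintegral_epsCoinLaw_prod ε (n + 1)
      fun s => if s < n then Set.indicator {(u s).2.1} 1 else g
    rw [Finset.prod_range_succ] at this
    simp only [lt_irrefl, if_false] at this
    rw [Finset.prod_congr rfl (g := fun s => bernoulliMeasure true false ε {(u s).2.1})
      fun s hs => ?_] at this
    · rw [← this]
      refine lintegral_congr fun e => ?_
      simp only [coins]
      rw [Finset.prod_range_succ, if_neg (lt_irrefl n)]
      congr 1
      exact Finset.prod_congr rfl fun s hs => by rw [if_pos (Finset.mem_range.1 hs)]
    · rw [if_pos (Finset.mem_range.1 hs)]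
      exact lintegral_indicator_one (measurableSet_singleton _)
  have hG : Measurable fun θ : Env d (Bool × S) × (ℕ → Bool) => coins θ.2 * sites θ.1 :=
    (hcoins.comp measurable_snd).mul (hsites.comp measurable_fst)
  have h0 : pathOf u 0 = 0 := by simp [pathOf]
  have hprod : Measurable fun ζ : Env d (Bool × S) =>
      ∏ y ∈ V, (∏ s ∈ Finset.range n, w y s (ζ y s)) * h y (ζ y n) := by
    refine Finset.measurable_prod _ fun y _ => Measurable.mul ?_ ((hh y).comp (hev y n))
    exact Finset.measurable_prod _ fun s _ => (hw y s).comp (hev y s)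
  rw [step1, setLIntegral_extendedLaw_segment p K π κ ε q 0 n (pathOf u) hG, h0]
  simp only [Set.indicator_of_mem (Set.mem_singleton (0 : LatticePt d)), Pi.one_apply, one_mul,
    step2]
  simp only [lintegral_mul_const _ hcoins, step3]
  rw [lintegral_const_mul _ hprod]
  congr 1
  have h5 := lintegral_infinitePi_prod
    (fun _ : LatticePt d => chainLaw ((Measure.dirac false).prod π) fun _ => coinStep K π κ) V
    (F := fun y z => (∏ s ∈ Finset.range n, w y s (z s)) * h y (z n)) fun y =>
      (Finset.measurable_prod _ fun s _ => (hw y s).comp (measurable_pi_apply s)).mul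
        ((hh y).comp (measurable_pi_apply n))
  rw [coinEnvLaw, h5]
  exact Finset.prod_congr rfl fun y _ => lintegral_coinChain n (hw y) (hh y)

/-- The law of the observations. -/
def observationLaw : Measure (ℕ → Observation d) := (extendedLaw p K π κ ε q 0).map observe

instance : IsProbabilityMeasure (observationLaw p K π κ ε q) :=
  Measure.isProbabilityMeasure_map measurable_observe.aemeasurable

/-- The sites which matter for the first `n` observations. -/
def relevantSites (n : ℕ) (u : ℕ → Observation d) : Finset (LatticePt d) :=
  (Finset.range n).image (pathOf u) ∪ (Finset.range (n + 1)).biUnion (pendingOf u)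

/-- Allowing any larger `V` lets the probabilities of different segments be compared over one common
set of sites. -/
theorem observationLaw_segment (n : ℕ) (u : ℕ → Observation d) {V : Finset (LatticePt d)}
    (hV : relevantSites n u ⊆ V) : observationLaw p K π κ ε q (segment n u) =
      (∏ s ∈ Finset.range n, bernoulliMeasure true false ε {(u s).2.1}) *
        ∏ y ∈ V, siteFactor p K π κ ε q n u y fun _ => 1 := by
  have h := setLIntegral_observe p K π κ ε q n u (V := V)
    (fun s hs => hV (Finset.mem_union_left _ (Finset.mem_image_of_mem _ (Finset.mem_range.2 hs))))
    (fun s hs => (Finset.subset_biUnion_of_mem (pendingOf u)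
      (Finset.mem_range.2 (Nat.lt_succ_of_le hs))).trans (Finset.subset_union_right.trans hV))
    (fun _ => 1) (h := fun _ _ => 1) fun _ => measurable_const
  simp only [Finset.prod_const_one, mul_one, lintegral_const, measure_univ, one_mul,
    Measure.restrict_apply_univ] at h
  rw [observationLaw, Measure.map_apply measurable_observe (measurableSet_segment n u), h]

end Cylinders

/-! ### Renewal, drift and displacement of the observations -/

section Regeneration

variable {d : ℕ} {S : Type*} [MeasurableSpace S] {p : Kernel S (LatticePt d)} [IsMarkovKernel p]
  {K : Kernel S S} [IsMarkovKernel K] {π : Measure S} [IsProbabilityMeasure π] {κ ε : I}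
  {q : Measure (LatticePt d)} [IsProbabilityMeasure q]

/-- This is `siteExp_regeneration` with the future read in the frame of the walk at time `t`: the
site `y` becomes `y - pathOf u t`. -/
theorem siteFactor_regeneration (hK : Minorized K π κ) (hπ : K.Invariant π) (t n : ℕ)
    {u : ℕ → Observation d} (hu : pendingOf u t = ∅) (y : LatticePt d) :
    siteFactor p K π κ ε q (t + n) u y (fun _ => 1) =
      siteFactor p K π κ ε q t u y (fun _ => 1) *
        siteFactor p K π κ ε q n (shiftSeq t u) (y - pathOf u t) fun _ => 1 := by
  have h := (siteExp_regeneration hK hπ t n (measurable_jumpWeightOf p ε q u y)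
    (jumpWeightOf_const p ε q u y) (b := isPendingOf u y) (by simp [isPendingOf, hu])).1
    (by simp [isPendingOf, pendingOf])
  have hpath : ∀ s, pathOf u (t + s) = y ↔ pathOf (shiftSeq t u) s = y - pathOf u t := fun s => by
    rw [pathOf_shiftSeq, sub_left_inj]
  have h1 : (fun s => jumpWeightOf p ε q u y (t + s)) =
      jumpWeightOf p ε q (shiftSeq t u) (y - pathOf u t) := by
    funext s x
    simp only [jumpWeightOf, hpath s]
    rfl
  have h2 : (fun s => visitOf u y (t + s)) = visitOf (shiftSeq t u) (y - pathOf u t) := by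
    funext s
    simp only [visitOf, hpath s]
    rfl
  have h3 : (fun s => isPendingOf u y (t + s)) = isPendingOf (shiftSeq t u) (y - pathOf u t) := by
    funext s
    simp only [isPendingOf, mem_pendingOf_shiftSeq hu s, sub_add_cancel]
  rw [h1, h2, h3] at h
  exact h

/-- With no site pending, every site factor splits, and so does the product of the `ε`-coin
probabilities. The future factors are indexed by the translated set of sites. -/
theorem renewsAt_observationLaw (hK : Minorized K π κ) (hπ : K.Invariant π) :
    RenewsAt (observationLaw p K π κ ε q) {o | pendingCount o = 0} := by
  intro t n u hu
  have hu' : pendingOf u (t + 1) = ∅ := by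
    rw [← Finset.card_eq_zero, card_pendingOf_succ]
    exact hu
  set V := relevantSites (t + 1 + n) u with hV
  have h1 : relevantSites (t + 1) u ⊆ V :=
    Finset.union_subset_union
      (Finset.image_subset_image (Finset.range_subset_range.2 (by omega)))
      (Finset.biUnion_subset_biUnion_of_subset_left _ (Finset.range_subset_range.2 (by omega)))
  have h2 : relevantSites n (shiftSeq (t + 1) u) ⊆ V.image (· - pathOf u (t + 1)) := by
    intro y hy
    refine Finset.mem_image.2 ⟨y + pathOf u (t + 1), ?_, add_sub_cancel_right _ _⟩
    rcases Finset.mem_union.1 hy with hy | hy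
    · obtain ⟨s, hs, rfl⟩ := Finset.mem_image.1 hy
      rw [pathOf_shiftSeq, sub_add_cancel]
      exact Finset.mem_union_left _ (Finset.mem_image_of_mem _
        (Finset.mem_range.2 (by have := Finset.mem_range.1 hs; omega)))
    · obtain ⟨s, hs, hys⟩ := Finset.mem_biUnion.1 hy
      rw [mem_pendingOf_shiftSeq hu'] at hys
      exact Finset.mem_union_right _ (Finset.mem_biUnion.2
        ⟨_, Finset.mem_range.2 (by have := Finset.mem_range.1 hs; omega), hys⟩)
  rw [observationLaw_segment p K π κ ε q _ u (subset_refl V),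
    observationLaw_segment p K π κ ε q _ u h1, observationLaw_segment p K π κ ε q _ _ h2,
    Finset.prod_range_add, Finset.prod_image (fun a _ b _ h => sub_left_injective h)]
  simp only [siteFactor_regeneration hK hπ (t + 1) n hu', Finset.prod_mul_distrib, shiftSeq]
  ring

theorem chainExp_mul_const {E : Type*} [MeasurableSpace E] (κ : ℕ → Kernel E E) (n : ℕ)
    (f : ℕ → E → ℝ≥0∞) (h : E → ℝ≥0∞) {c : ℝ≥0∞} (hc : c ≠ ∞) (x : E) :
    chainExp κ n f (fun x => h x * c) x = chainExp κ n f h x * c := by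
  induction n generalizing h with
  | zero => rfl
  | succ n ih =>
    rw [chainExp, chainExp, ← ih]
    simp only [lintegral_mul_const' _ _ hc, mul_assoc]

/-- A `κ`-coin is independent of the earlier observations. -/
theorem siteFactor_coin (t : ℕ) (u : ℕ → Observation d) (y : LatticePt d) :
    siteFactor p K π κ ε q (t + 1) u y (fun x => if x.1 = false then 1 else 0) =
      siteFactor p K π κ ε q (t + 1) u y (fun _ => 1) * unitInterval.toNNReal (σ κ) := by
  rw [siteFactor, siteFactor, ← lintegral_mul_const' _ _ ENNReal.coe_ne_top]
  refine lintegral_congr fun x => ?_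
  -- The coin of the last step enters no earlier weight, so integrating that step first gives the
  -- constant factor `1 - κ`.
  rw [chainExp, chainExp, ← chainExp_mul_const _ _ _ _ ENNReal.coe_ne_top]
  congr 1
  funext z
  have hm : Measurable fun x : Bool × S => if x.1 = false then (1 : ℝ≥0∞) else 0 :=
    (measurable_of_countable fun a : Bool => if a = false then (1 : ℝ≥0∞) else 0).comp
      measurable_fst
  rw [lintegral_coinStep K π κ z hm]
  simp

theorem relevantSites_visit {n s : ℕ} (hs : s < n) (u : ℕ → Observation d) :
    pathOf u s ∈ relevantSites n u :=
  Finset.mem_union_left _ (Finset.mem_image_of_mem _ (Finset.mem_range.2 hs))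

theorem relevantSites_pending {n s : ℕ} (hs : s ≤ n) (u : ℕ → Observation d) :
    pendingOf u s ⊆ relevantSites n u :=
  (Finset.subset_biUnion_of_mem (pendingOf u) (Finset.mem_range.2 (Nat.lt_succ_of_le hs))).trans
    Finset.subset_union_right

theorem setLIntegral_observe_coin (t : ℕ) (u : ℕ → Observation d) {y : LatticePt d}
    (hy : y ∈ pendingOf u (t + 1)) :
    ∫⁻ z in observe ⁻¹' segment (t + 1) u, (if (z.1.1 y (t + 1)).1 = false then 1 else 0)
        ∂(extendedLaw p K π κ ε q 0) =
      observationLaw p K π κ ε q (segment (t + 1) u) * unitInterval.toNNReal (σ κ) := by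
  have hyV := relevantSites_pending le_rfl u hy
  have h := setLIntegral_observe p K π κ ε q (t + 1) u (fun s hs => relevantSites_visit hs u)
    (fun s hs => relevantSites_pending hs u) (fun _ => 1)
    (h := fun y' => if y' = y then fun x => if x.1 = false then 1 else 0 else fun _ => 1)
    fun y' => by
      split_ifs
      · exact (measurable_of_countable fun a : Bool => if a = false then (1 : ℝ≥0∞) else 0).comp
          measurable_fst
      · exact measurable_const
  rw [observationLaw_segment p K π κ ε q _ u (subset_refl _)]
  have h1 : ∀ z : (Env d (Bool × S) × (ℕ → Bool)) × (ℕ → LatticePt d),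
      ∏ y' ∈ relevantSites (t + 1) u, (if y' = y then fun x : Bool × S =>
        if x.1 = false then (1 : ℝ≥0∞) else 0 else fun _ => 1) (z.1.1 y' (t + 1)) =
      if (z.1.1 y (t + 1)).1 = false then 1 else 0 := fun z => by
    rw [Finset.prod_eq_single_of_mem y hyV fun y' _ hne => by simp [hne]]
    simp
  have h2 : ∏ y' ∈ relevantSites (t + 1) u, siteFactor p K π κ ε q (t + 1) u y'
      (if y' = y then fun x : Bool × S => if x.1 = false then 1 else 0 else fun _ => 1) =
      (∏ y' ∈ relevantSites (t + 1) u, siteFactor p K π κ ε q (t + 1) u y' fun _ => 1) *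
        unitInterval.toNNReal (σ κ) := by
    rw [← Finset.mul_prod_erase _ _ hyV, ← Finset.mul_prod_erase (relevantSites (t + 1) u)
      (fun y' => siteFactor p K π κ ε q (t + 1) u y' fun _ => 1) hyV, if_pos rfl, siteFactor_coin,
      mul_right_comm]
    congr 2
    refine Finset.prod_congr rfl fun y' hy' => ?_
    rw [if_neg (Finset.ne_of_mem_erase hy')]
  simp only [h1, h2, one_mul, lintegral_const, measure_univ, mul_one] at h
  rw [h, mul_assoc]

/-- An `ε`-coin is independent of the earlier observations. -/
theorem setLIntegral_observe_epsCoin (n : ℕ) (u : ℕ → Observation d) :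
    ∫⁻ z in observe ⁻¹' segment n u, (if z.1.2 (n + 1) = false then 1 else 0)
        ∂(extendedLaw p K π κ ε q 0) =
      observationLaw p K π κ ε q (segment n u) * unitInterval.toNNReal (σ ε) := by
  have h := setLIntegral_observe p K π κ ε q n u (fun s hs => relevantSites_visit hs u)
    (fun s hs => relevantSites_pending hs u) (fun a => if a = false then 1 else 0)
    (h := fun _ _ => 1) fun _ => measurable_const
  rw [lintegral_bernoulli] at h
  simp only [Finset.prod_const_one, mul_one] at h
  rw [h, observationLaw_segment p K π κ ε q _ u (subset_refl _)]
  simp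
  ring

theorem card_pendingSites_succ_le (z : (Env d (Bool × S) × (ℕ → Bool)) × (ℕ → LatticePt d))
    (t : ℕ) : ((pendingSites z (t + 1)).card : ℝ≥0∞) ≤
      ∑ y ∈ pendingSites z t, (if (z.1.1 y t).1 = false then 1 else 0) +
        if z.1.2 (t + 1) = false then 1 else 0 := by
  rw [pendingSites]
  refine (Nat.cast_le.2 (Finset.card_union_le _ _)).trans ?_
  rw [Nat.cast_add, Finset.card_filter, Nat.cast_sum]
  refine add_le_add (Finset.sum_le_sum fun y _ => ?_) ?_
  · split_ifs <;> simp
  · cases z.1.2 (t + 1) <;> simp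

theorem measurable_pendingCount_eval (t : ℕ) :
    Measurable fun w : ℕ → Observation d => (pendingCount (w t) : ℝ≥0∞) :=
  (measurable_of_countable fun o : Observation d => (pendingCount o : ℝ≥0∞)).comp
    (measurable_pi_apply t)

/-- Each pending site survives with probability `1 - κ`, and a new one is added with probability at
most `1 - ε`, both independently of the observations so far. -/
theorem hasDrift_observationLaw (hle : unitInterval.toNNReal (σ ε) ≤ unitInterval.toNNReal κ) :
    HasDrift (observationLaw p K π κ ε q) pendingCount
      (unitInterval.toNNReal κ - unitInterval.toNNReal (σ ε) : ℝ≥0∞) := by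
  intro t u hu
  set P := observationLaw p K π κ ε q (segment (t + 1) u)
  have hs : MeasurableSet (segment (t + 1) u) := measurableSet_segment _ _
  have h1 : ∫⁻ w in segment (t + 1) u, (pendingCount (w (t + 1)) : ℝ≥0∞)
      ∂(observationLaw p K π κ ε q) ≤ pendingCount (u t) * (P * unitInterval.toNNReal (σ κ)) +
        P * unitInterval.toNNReal (σ ε) := by
    have hm : ∀ y : LatticePt d, Measurable
        fun z : (Env d (Bool × S) × (ℕ → Bool)) × (ℕ → LatticePt d) =>
        if (z.1.1 y (t + 1)).1 = false then (1 : ℝ≥0∞) else 0 := fun y =>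
      (measurable_of_countable fun a : Bool => if a = false then (1 : ℝ≥0∞) else 0).comp
        (by fun_prop : Measurable fun z : (Env d (Bool × S) × (ℕ → Bool)) × (ℕ → LatticePt d) =>
          (z.1.1 y (t + 1)).1)
    rw [observationLaw, setLIntegral_map hs (measurable_pendingCount_eval _) measurable_observe]
    calc ∫⁻ z in observe ⁻¹' segment (t + 1) u, (pendingCount (observe z (t + 1)) : ℝ≥0∞)
          ∂(extendedLaw p K π κ ε q 0)
        ≤ ∫⁻ z in observe ⁻¹' segment (t + 1) u,
            (∑ y ∈ pendingOf u (t + 1), (if (z.1.1 y (t + 1)).1 = false then 1 else 0) +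
              if z.1.2 (t + 1 + 1) = false then 1 else 0) ∂(extendedLaw p K π κ ε q 0) := by
          -- On the segment the random pending set equals `pendingOf u (t + 1)`, so the sum has a
          -- deterministic index set.
          refine setLIntegral_mono_ae' (measurable_observe hs) ?_
          filter_upwards [ae_extendedLaw_start p K π κ ε q 0] with z hz hmem
          rw [pendingCount_observe, ← ((observe_mem_segment_iff hz _ u).1 hmem).2.2 (t + 1) le_rfl]
          exact card_pendingSites_succ_le z (t + 1)
      _ = _ := by
          rw [lintegral_add_left (Finset.measurable_sum _ fun y _ => hm y),
            lintegral_finsetSum _ fun y _ => hm y, setLIntegral_observe_epsCoin,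
            Finset.sum_congr rfl fun y hy => setLIntegral_observe_coin t u hy, Finset.sum_const,
            card_pendingOf_succ, nsmul_eq_mul]
  refine (add_le_add_left h1 _).trans ?_
  have hκ := toNNReal_add_toNNReal_symm κ
  have hN : (1 : ℝ≥0∞) ≤ pendingCount (u t) := by
    exact_mod_cast Nat.one_le_iff_ne_zero.2 hu
  have hle' : (unitInterval.toNNReal (σ ε) : ℝ≥0∞) ≤ unitInterval.toNNReal κ := by
    exact_mod_cast hle
  -- The total inflow and drift is exactly `κ`, which a single pending site already compensates.
  calc (pendingCount (u t) : ℝ≥0∞) * (P * unitInterval.toNNReal (σ κ)) +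
        P * unitInterval.toNNReal (σ ε) +
        (unitInterval.toNNReal κ - unitInterval.toNNReal (σ ε) : ℝ≥0∞) * P
      = P * (pendingCount (u t) * unitInterval.toNNReal (σ κ) +
          (unitInterval.toNNReal (σ ε) + (unitInterval.toNNReal κ -
            unitInterval.toNNReal (σ ε)))) := by ring
    _ ≤ P * (pendingCount (u t) * unitInterval.toNNReal (σ κ) +
          pendingCount (u t) * unitInterval.toNNReal κ) := by
        rw [add_tsub_cancel_of_le hle']
        gcongr
        exact le_mul_of_one_le_left zero_le hN
    _ = pendingCount (u t) * P := by
        rw [← mul_add, add_comm (unitInterval.toNNReal (σ κ) : ℝ≥0∞), hκ, mul_one, mul_comm]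

theorem lintegral_pendingCount_zero_le :
    ∫⁻ w, (pendingCount (w 0) : ℝ≥0∞) ∂(observationLaw p K π κ ε q) ≤ 1 := by
  rw [observationLaw, lintegral_map (measurable_pendingCount_eval 0) measurable_observe]
  calc _ ≤ ∫⁻ _, 1 ∂(extendedLaw p K π κ ε q 0) := by
        refine lintegral_mono fun z => ?_
        dsimp only
        rw [pendingCount_observe]
        refine (card_pendingSites_succ_le z 0).trans ?_
        simp only [pendingSites, Finset.sum_empty, zero_add]
        split_ifs <;> simp
    _ = 1 := by simp

/-- Since `ε² ≤ ε`, the trade-off implies `κ + ε > 1`, which is all that the drift needs. -/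
theorem Assumption.symm_eps_lt_kappa (hA : Assumption p K π κ ε q) :
    unitInterval.toNNReal (σ ε) < unitInterval.toNNReal κ := by
  have h1 := hA.trade_off
  have h2 : (ε : ℝ) ^ 2 ≤ ε := by
    have := mul_le_mul_of_nonneg_left ε.2.2 ε.2.1
    simpa [sq] using this
  rw [← NNReal.coe_lt_coe]
  simp only [unitInterval.coe_toNNReal, unitInterval.coe_symm_eq]
  linarith

theorem Assumption.integrable_blockLength (hA : Assumption p K π κ ε q) :
    (∀ᵐ w ∂(observationLaw p K π κ ε q), ∃ n, w n ∈ {o : Observation d | pendingCount o = 0}) ∧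
      Integrable (fun w => (blockLength {o : Observation d | pendingCount o = 0} w : ℝ))
        (observationLaw p K π κ ε q) :=
  (hasDrift_observationLaw hA.symm_eps_lt_kappa.le).integrable_blockLength
    (tsub_pos_of_lt (by exact_mod_cast hA.symm_eps_lt_kappa)).ne'
    (ne_top_of_le_ne_top ENNReal.one_ne_top lintegral_pendingCount_zero_le)

open Classical in
/-- The step of an observation, replaced by `0` if it does not lead to a nearest neighbour. -/
def stepOf (o : Observation d) : Fin d → ℝ := if o.1 ∈ nbhd d then toVec o.1 else 0

theorem norm_stepOf_le (o : Observation d) : ‖stepOf o‖ ≤ 1 := by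
  unfold stepOf
  split_ifs with h
  · refine (pi_norm_le_iff_of_nonneg zero_le_one).2 fun i => ?_
    have h1 : |o.1 i| ≤ 1 :=
      (Finset.single_le_sum (f := fun i => |o.1 i|) (fun _ _ => abs_nonneg _)
        (Finset.mem_univ i)).trans h
    rw [toVec, Real.norm_eq_abs]
    exact_mod_cast h1
  · simp

/-- The truncation in `stepOf` makes the functional bounded on all observations. On
nearest-neighbour paths it changes nothing and the sum telescopes. -/
theorem sum_stepOf_observe {z : (Env d (Bool × S) × (ℕ → Bool)) × (ℕ → LatticePt d)}
    (hz : z.2 0 = 0) (hstep : ∀ n, z.2 (n + 1) - z.2 n ∈ nbhd d) (n : ℕ) :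
    ∑ s ∈ Finset.range n, stepOf (observe z s) = toVec (z.2 n) := by
  induction n with
  | zero => ext i; simp [hz, toVec]
  | succ n ih =>
    rw [Finset.sum_range_succ, ih, stepOf, if_pos (show (observe z n).1 ∈ nbhd d from hstep n)]
    ext i
    simp [observe, toVec]

end Regeneration

end DynRWRE

end

/-! ### The law of large numbers -/

open DynRWRE in
theorem theorem1 {d : ℕ} (hd : 1 ≤ d)
    {S : Type*} [TopologicalSpace S] [PolishSpace S] [MeasurableSpace S] [BorelSpace S]
    (p : Kernel S (LatticePt d)) [IsMarkovKernel p] (hp : ∀ s, p s (nbhd d)ᶜ = 0)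
    (K : Kernel S S) [IsMarkovKernel K] (π : Measure S) [IsProbabilityMeasure π]
    (hπ : K.Invariant π)
    (hπ_unique : ∀ ν : Measure S, IsProbabilityMeasure ν → K.Invariant ν → ν = π)
    (κ ε : unitInterval) (q : Measure (LatticePt d)) [IsProbabilityMeasure q]
    (hA : Assumption p K π κ ε q) :
    ∃ v : Fin d → ℝ,
      (∀ᵐ z ∂(annealedLaw p K π 0),
        Tendsto (fun n : ℕ => (n : ℝ)⁻¹ • toVec (z.2 n)) atTop (𝓝 v)) ∧
      (∀ᵐ z ∂(extendedLaw p K π κ ε q 0), regenTime z < ⊤) ∧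
      Integrable (fun z => ((regenTime z).toNat : ℝ)) (extendedLaw p K π κ ε q 0) ∧
      Integrable (fun z => toVec (z.2 (regenTime z).toNat)) (extendedLaw p K π κ ε q 0) ∧
      v = (∫ z, ((regenTime z).toNat : ℝ) ∂(extendedLaw p K π κ ε q 0))⁻¹ •
        ∫ z, toVec (z.2 (regenTime z).toNat) ∂(extendedLaw p K π κ ε q 0) := by
  set D : Set (Observation d) := {o | pendingCount o = 0}
  set P := extendedLaw p K π κ ε q 0
  set μ := observationLaw p K π κ ε q
  obtain ⟨hD, hσ⟩ := hA.integrable_blockLength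
  have hobs : AEMeasurable (observe : _ → ℕ → Observation d) P := measurable_observe.aemeasurable
  have hlen : ∀ᵐ z ∂P, regenTime z = blockLength D (observe z) := by
    filter_upwards [ae_of_ae_map hobs hD] with z hz
    exact exists_blockLength_observe hz
  have hpos : ∀ᵐ z ∂P, ∀ n, ∑ s ∈ Finset.range n, stepOf (observe z s) = toVec (z.2 n) := by
    filter_upwards [ae_extendedLaw_start p K π κ ε q 0, ae_steps_mem_nbhd hp hA 0] with z h1 h2
    exact sum_stepOf_observe h1 h2
  have hsum : Integrable (blockSum D stepOf) μ := integrable_blockSum hσ norm_stepOf_le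
  have hlen' : (fun z => (blockLength D (observe z) : ℝ)) =ᵐ[P]
      fun z => ((regenTime z).toNat : ℝ) := by
    filter_upwards [hlen] with z hz
    rw [hz, ENat.toNat_natCast]
  have hsum' : (fun z => blockSum D stepOf (observe z)) =ᵐ[P]
      fun z => toVec (z.2 (regenTime z).toNat) := by
    filter_upwards [hlen, hpos] with z h1 h2
    rw [h1, ENat.toNat_natCast, ← h2]
    rfl
  -- The velocity is the ratio of mean displacement to mean length of a block of observations. By
  -- `hlen'` and `hsum'` these are almost surely `X_{τ₁}` and `τ₁`.
  refine ⟨(∫ w, (blockLength D w : ℝ) ∂μ)⁻¹ • ∫ w, blockSum D stepOf w ∂μ, ?_, ?_, ?_, ?_, ?_⟩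
  · have hlim := (renewsAt_observationLaw (p := p) (ε := ε) (q := q) hA.minorized
      hπ).tendsto_average hD hσ norm_stepOf_le
    have hmeas : MeasurableSet {X : ℕ → LatticePt d | Tendsto (fun n : ℕ => (n : ℝ)⁻¹ • toVec (X n))
        atTop (𝓝 ((∫ w, (blockLength D w : ℝ) ∂μ)⁻¹ • ∫ w, blockSum D stepOf w ∂μ))} :=
      measurableSet_tendsto _ fun n =>
        (measurable_of_countable fun x : LatticePt d => (n : ℝ)⁻¹ • toVec x).comp
          (measurable_pi_apply n)
    have hext : ∀ᵐ X ∂(P.map Prod.snd), Tendsto (fun n : ℕ => (n : ℝ)⁻¹ • toVec (X n))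
        atTop (𝓝 ((∫ w, (blockLength D w : ℝ) ∂μ)⁻¹ • ∫ w, blockSum D stepOf w ∂μ)) := by
      rw [ae_map_iff measurable_snd.aemeasurable hmeas]
      filter_upwards [ae_of_ae_map hobs hlim, hpos] with z h1 h2
      simpa only [h2] using h1
    -- The convergence concerns the walk alone, whose law is the same with and without the coins.
    rw [map_snd_extendedLaw hA hπ] at hext
    exact ae_of_ae_map measurable_snd.aemeasurable hext
  · filter_upwards [hlen] with z hz
    rw [hz]
    exact ENat.natCast_lt_top _
  · exact ((integrable_map_measure hσ.aestronglyMeasurable hobs).1 hσ).congr hlen'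
  · exact ((integrable_map_measure hsum.aestronglyMeasurable hobs).1 hsum).congr hsum'
  · rw [← integral_congr_ae hlen', ← integral_congr_ae hsum',
      ← integral_map hobs hσ.aestronglyMeasurable, ← integral_map hobs hsum.aestronglyMeasurable]
    rfl
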